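/- Let $H$ be a separable complex Hilbert space, let $H^{\otimes n}$ denote its $n$-th Hilbert-space tensor power, and let $T$ be a self-adjoint bounded linear operator on $H^{\otimes 2}$ with $\|T\|\le 1$ satisfying the Yang–Baxter equation on $H^{\otimes 3}$: $$(T\otimes \mathbf 1)(\mathbf 1\otimes T)(T\otimes \mathbf 1)=(\mathbf 1\otimes T)(T\otimes \mathbf 1)(\mathbf 1\otimes T).$$ For $n\ge 2$ and $1\le i\le n-1$ let $T_i:=\mathbf 1_{H^{\otimes (i-1)}}\otimes T\otimes \mathbf 1_{H^{\otimes (n-i-1)}}$ on $H^{\otimes n}$. For a permutation $\sigma\in S_n$ choose a word $\sigma=\sigma_{j_1}\cdots\sigma_{j_m}$ of minimal length in the adjacent transpositions $\sigma_j=(j,j+1)$ and put $T_\sigma:=T_{j_1}\cdots T_{j_m}$ (this does not depend on the choice, because of the Yang–Baxter equation). Let $$\mathcal P_n:=\sum_{\sigma\in S_n}T_\sigma,\qquad \mathcal F_n(H):=(\ker \mathcal P_n)^\perp\subseteq H^{\otimes n}.$$ Then, for every $n\ge 2$, $$\mathcal F_n(H)=\big\{f\in H^{\otimes n} : (\mathbf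 1-T_i)f\in\overline{\operatorname{ran}(\mathbf 1-T_i^2)}\ \text{ for all } i=1,\dots,n-1\big\}.$$ -/

import Mathlib

open scoped TensorProduct

universe u v w

namespace HilbertTensor

noncomputable section

section Binary

variable (E : Type u) (F : Type v) (G : Type w)
  [NormedAddCommGroup E] [InnerProductSpace ℂ E]
  [NormedAddCommGroup F] [InnerProductSpace ℂ F]
  [NormedAddCommGroup G] [InnerProductSpace ℂ G]

/-- The Hilbert-space tensor product of `E` and `F`: the completion of the algebraic tensor product
`E ⊗ F` for the inner product with `⟪a ⊗ b, c ⊗ d⟫ = ⟪a, c⟫ * ⟪b, d⟫`. -/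
abbrev HTensor : Type (max u v) := UniformSpace.Completion (E ⊗[ℂ] F)

variable {E F G}

/-- The elementary tensor `x ⊗ y` in the Hilbert-space tensor product. -/
def htmul (x : E) (y : F) : HTensor E F := ((x ⊗ₜ[ℂ] y : E ⊗[ℂ] F) : HTensor E F)

/-- The bounded operator `f ⊗ g` between Hilbert-space tensor products, determined by
`(f ⊗ g) (x ⊗ y) = f x ⊗ g y`. -/
def hmap {E' : Type*} {F' : Type*} [NormedAddCommGroup E'] [InnerProductSpace ℂ E']
    [NormedAddCommGroup F'] [InnerProductSpace ℂ F'] (f : E →L[ℂ] E') (g : F →L[ℂ] F') :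
    HTensor E F →L[ℂ] HTensor E' F' :=
  (TensorProduct.mapL f g).completion

theorem hmap_htmul {E' : Type*} {F' : Type*} [NormedAddCommGroup E'] [InnerProductSpace ℂ E']
    [NormedAddCommGroup F'] [InnerProductSpace ℂ F'] (f : E →L[ℂ] E') (g : F →L[ℂ] F')
    (x : E) (y : F) : hmap f g (htmul x y) = htmul (f x) (g y) := by
  simp [hmap, htmul]

/-- The span of the elementary tensors `x ⊗ y`, with `x` in a dense set, is dense. -/
theorem closure_eq_top_of_htmul_mem {D : Type*} {j : D → E} (hj : DenseRange j)
    (S : Submodule ℂ (HTensor E F)) (hS : ∀ d y, htmul (j d) y ∈ S) :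
    S.topologicalClosure = ⊤ := by
  have h1 : ∀ x y, htmul x y ∈ S.topologicalClosure := by
    intro x y
    have hc : Continuous fun x : E => (htmul x y : HTensor E F) :=
      (UniformSpace.Completion.continuous_coe _).comp
        (TensorProduct.continuous_tmul.comp (continuous_id.prodMk continuous_const))
    have : closure (Set.range j) ⊆
        (fun x : E => (htmul x y : HTensor E F)) ⁻¹' (S.topologicalClosure : Set (HTensor E F)) :=
      closure_minimal (by rintro _ ⟨d, rfl⟩; exact S.le_topologicalClosure (hS d y))
        (S.isClosed_topologicalClosure.preimage hc)
    exact this (hj x)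
  have h2 : ∀ t : E ⊗[ℂ] F, (t : HTensor E F) ∈ S.topologicalClosure := by
    intro t
    induction t with
    | zero => rw [UniformSpace.Completion.coe_zero]; exact zero_mem _
    | tmul x y => exact h1 x y
    | add a b ha hb => rw [UniformSpace.Completion.coe_add]; exact add_mem ha hb
  refine (Submodule.eq_top_iff').2 fun z => ?_
  induction z using UniformSpace.Completion.induction_on with
  | hp => exact S.isClosed_topologicalClosure
  | ih t => exact h2 t

variable (E F G)

/-- The canonical map `(E ⊗ F) ⊗ G → (E ⊗ F) ⊗ G` from the algebraic to the Hilbert-space tensor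
product, `(x ⊗ y) ⊗ z ↦ (x ⊗ y) ⊗ z`. -/
def algToLeft : (E ⊗[ℂ] F) ⊗[ℂ] G →ₗᵢ[ℂ] HTensor (HTensor E F) G :=
  UniformSpace.Completion.toComplₗᵢ.comp (UniformSpace.Completion.toComplₗᵢ.rTensor G)

/-- The canonical map `E ⊗ (F ⊗ G) → E ⊗ (F ⊗ G)` from the algebraic to the Hilbert-space tensor
product, `x ⊗ (y ⊗ z) ↦ x ⊗ (y ⊗ z)`. -/
def algToRight : E ⊗[ℂ] (F ⊗[ℂ] G) →ₗᵢ[ℂ] HTensor E (HTensor F G) :=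
  UniformSpace.Completion.toComplₗᵢ.comp (UniformSpace.Completion.toComplₗᵢ.lTensor E)

theorem denseRange_algToLeft : DenseRange (algToLeft E F G) := by
  have h := closure_eq_top_of_htmul_mem (F := G)
    (UniformSpace.Completion.denseRange_coe (α := E ⊗[ℂ] F))
    (LinearMap.range (algToLeft E F G).toLinearMap) (fun d y => ⟨d ⊗ₜ y, rfl⟩)
  exact Submodule.dense_iff_topologicalClosure_eq_top.2 h

theorem denseRange_algToRight : DenseRange (algToRight E F G) := by
  have h : (LinearMap.range (algToRight E F G).toLinearMap).topologicalClosure = ⊤ := by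
    rw [eq_top_iff, ← closure_eq_top_of_htmul_mem (E := E) (F := HTensor F G) (denseRange_id)
      (LinearMap.range (algToRight E F G).toLinearMap).topologicalClosure]
    · exact Submodule.topologicalClosure_minimal _ le_rfl
        (Submodule.isClosed_topologicalClosure _)
    · intro x y
      have hc : Continuous fun y : HTensor F G => (htmul x y : HTensor E (HTensor F G)) :=
        (UniformSpace.Completion.continuous_coe _).comp
          (TensorProduct.continuous_tmul.comp (continuous_const.prodMk continuous_id))
      induction y using UniformSpace.Completion.induction_on with
      | hp => exact (Submodule.isClosed_topologicalClosure _).preimage hc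
      | ih t => exact Submodule.le_topologicalClosure _ ⟨x ⊗ₜ t, rfl⟩
  exact Submodule.dense_iff_topologicalClosure_eq_top.2 h

/-- The canonical unitary identification `(E ⊗ F) ⊗ G ≃ E ⊗ (F ⊗ G)` of Hilbert-space tensor
products, determined by `(x ⊗ y) ⊗ z ↦ x ⊗ (y ⊗ z)`. -/
def hassoc : HTensor (HTensor E F) G ≃ₗᵢ[ℂ] HTensor E (HTensor F G) :=
  (TensorProduct.assoc ℂ E F G).extendOfIsometry
    (algToLeft E F G).toLinearMap (algToRight E F G).toLinearMap
    (denseRange_algToLeft E F G) (denseRange_algToRight E F G)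
    (fun x => by
      simp only [LinearIsometry.coe_toLinearMap, LinearIsometry.norm_map]
      exact TensorProduct.norm_assoc x)

theorem hassoc_htmul (x : E) (y : F) (z : G) :
    hassoc E F G (htmul (htmul x y) z) = htmul x (htmul y z) :=
  (TensorProduct.assoc ℂ E F G).extendOfIsometry_eq (e₁ := (algToLeft E F G).toLinearMap)
    (e₂ := (algToRight E F G).toLinearMap) (denseRange_algToLeft E F G)
    (denseRange_algToRight E F G) _ ((x ⊗ₜ y) ⊗ₜ z)

end Binary

section Power

/-- A complex Hilbert space, bundled. -/
structure HilbertSpaceCat : Type (u + 1) where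
  carrier : Type u
  [grp : NormedAddCommGroup carrier]
  [ips : InnerProductSpace ℂ carrier]
  [cmp : CompleteSpace carrier]

attribute [instance] HilbertSpaceCat.grp HilbertSpaceCat.ips HilbertSpaceCat.cmp

variable (H : Type u) [NormedAddCommGroup H] [InnerProductSpace ℂ H] [CompleteSpace H]

/-- The Hilbert space `H ⊗ K`, bundled. -/
def consBundle (K : HilbertSpaceCat.{u}) : HilbertSpaceCat.{u} := ⟨HTensor H K.carrier⟩

/-- The tensor powers of `H`, bundled: `ℂ` (as the one-dimensional Hilbert space in the universe of
`H`), `H`, `H ⊗ H`, `H ⊗ (H ⊗ H)`, and so on. -/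
def powBundle : ℕ → HilbertSpaceCat.{u}
  | 0 => ⟨EuclideanSpace ℂ PUnit.{u + 1}⟩
  | 1 => ⟨H⟩
  | n + 2 => consBundle H (powBundle (n + 1))

/-- The Hilbert-space tensor power `H^{⊗n}`. -/
def Pow (n : ℕ) : Type u := (powBundle H n).carrier

instance (n : ℕ) : NormedAddCommGroup (Pow H n) := (powBundle H n).grp
instance (n : ℕ) : InnerProductSpace ℂ (Pow H n) := (powBundle H n).ips
instance (n : ℕ) : CompleteSpace (Pow H n) := (powBundle H n).cmp

end Power

section Deformed

variable {H : Type u} [NormedAddCommGroup H] [InnerProductSpace ℂ H]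

/-- The operator `T ⊗ 1_K` on `H ⊗ H ⊗ K = H ⊗ (H ⊗ K)`. -/
def onFirstTwo (T : HTensor H H →L[ℂ] HTensor H H) (K : Type v) [NormedAddCommGroup K]
    [InnerProductSpace ℂ K] : HTensor H (HTensor H K) →L[ℂ] HTensor H (HTensor H K) :=
  (hassoc H H K).toContinuousLinearEquiv.toContinuousLinearMap ∘L
    hmap T (ContinuousLinearMap.id ℂ K) ∘L
      (hassoc H H K).symm.toContinuousLinearEquiv.toContinuousLinearMap

/-- The Yang–Baxter equation `(T ⊗ 1)(1 ⊗ T)(T ⊗ 1) = (1 ⊗ T)(T ⊗ 1)(1 ⊗ T)` on `H ⊗ H ⊗ H`. -/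
def YangBaxter (T : HTensor H H →L[ℂ] HTensor H H) : Prop :=
  onFirstTwo T H ∘L hmap (ContinuousLinearMap.id ℂ H) T ∘L onFirstTwo T H =
    hmap (ContinuousLinearMap.id ℂ H) T ∘L onFirstTwo T H ∘L hmap (ContinuousLinearMap.id ℂ H) T

variable [CompleteSpace H]

/-- The operator `T ⊗ 1_K` on the bundled Hilbert space `H ⊗ (H ⊗ K)`. -/
def consFirstTwo (T : HTensor H H →L[ℂ] HTensor H H) (K : HilbertSpaceCat.{u}) :
    (consBundle H (consBundle H K)).carrier →L[ℂ] (consBundle H (consBundle H K)).carrier :=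
  onFirstTwo T K.carrier

/-- The operator `1_H ⊗ A` on the bundled Hilbert space `H ⊗ K`. -/
def consTail {K : HilbertSpaceCat.{u}} (A : K.carrier →L[ℂ] K.carrier) :
    (consBundle H K).carrier →L[ℂ] (consBundle H K).carrier :=
  hmap (ContinuousLinearMap.id ℂ H) A

/-- The operators `T_1, …, T_{n-1}` on `H^{⊗n}`, where `T_i` acts as `T` on the `i`-th and
`(i+1)`-th tensor factors and as the identity on the others. As `Fin (n - 1)` starts at `0`,
`amp T n i` is `T_{i+1}`. -/
def amp (T : HTensor H H →L[ℂ] HTensor H H) : (n : ℕ) → Fin (n - 1) → (Pow H n →L[ℂ] Pow H n)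
  | 0, i => i.elim0
  | 1, i => i.elim0
  | 2, _ => T
  | n + 3, ⟨0, _⟩ => consFirstTwo T (powBundle H (n + 1))
  | n + 3, ⟨j + 1, h⟩ => consTail (K := powBundle H (n + 2)) (amp T (n + 2) ⟨j, by omega⟩)

/-- The adjacent transpositions of `{0, …, n-1}`; `adj n i` interchanges `i` and `i + 1`. -/
def adj (n : ℕ) (i : Fin (n - 1)) : Equiv.Perm (Fin n) :=
  Equiv.swap ⟨i, by omega⟩ ⟨i + 1, by omega⟩

/-- `w = [j_1, …, j_m]` is a reduced word for `σ`: the product of the corresponding adjacent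
transpositions is `σ`, and no shorter word has this property. -/
def IsReducedWord {n : ℕ} (σ : Equiv.Perm (Fin n)) (w : List (Fin (n - 1))) : Prop :=
  (w.map (adj n)).prod = σ ∧
    ∀ w' : List (Fin (n - 1)), (w'.map (adj n)).prod = σ → w.length ≤ w'.length

theorem exists_isReducedWord {n : ℕ} (σ : Equiv.Perm (Fin n)) :
    ∃ w : List (Fin (n - 1)), IsReducedWord σ w := by
  have hne : ∃ w : List (Fin (n - 1)), (w.map (adj n)).prod = σ := by
    cases n with
    | zero => exact ⟨[], Subsingleton.elim _ _⟩
    | succ m =>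
      have h : σ ∈ Submonoid.closure (Set.range (adj (m + 1))) := by
        have := Equiv.Perm.mclosure_swap_castSucc_succ m
        change Submonoid.closure (Set.range (adj (m + 1))) = ⊤ at this
        rw [this]; trivial
      obtain ⟨l, hl, rfl⟩ := Submonoid.exists_list_of_mem_closure h
      have h' : l ∈ Set.range (List.map (adj (m + 1))) := by
        rw [Set.range_list_map]; exact hl
      obtain ⟨w, rfl⟩ := h'
      exact ⟨w, rfl⟩
  obtain ⟨w, hw, hmin⟩ := exists_minimalFor_of_wellFoundedLT
    (fun w : List (Fin (n - 1)) => (w.map (adj n)).prod = σ) List.length hne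
  exact ⟨w, hw, fun w' hw' => (le_total w.length w'.length).elim id fun h => hmin hw' h⟩

/-- The operator `T_σ = T_{j_1} ⋯ T_{j_m}` on `H^{⊗n}`, for some reduced word `j_1, …, j_m` of the
permutation `σ`. (If `T` satisfies the Yang–Baxter equation, the choice of the word is immaterial.)
-/
def permOp (T : HTensor H H →L[ℂ] HTensor H H) {n : ℕ} (σ : Equiv.Perm (Fin n)) :
    Pow H n →L[ℂ] Pow H n :=
  ((exists_isReducedWord σ).choose.map (amp T n)).prod

/-- The operator `P_n = ∑_σ T_σ` on `H^{⊗n}`. -/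
def symmetrizer (T : HTensor H H →L[ℂ] HTensor H H) (n : ℕ) : Pow H n →L[ℂ] Pow H n :=
  ∑ σ : Equiv.Perm (Fin n), permOp T σ

/-- The `n`-particle space `F_n(H) = (ker P_n)ᗮ`, as a subspace of `H^{⊗n}`. -/
def nParticleSpace (T : HTensor H H →L[ℂ] HTensor H H) (n : ℕ) : Submodule ℂ (Pow H n) :=
  (LinearMap.ker (symmetrizer T n).toLinearMap)ᗮ

end Deformed

end

end HilbertTensor

/-! For a self-adjoint `B`, the closure of `ran (1 - B²)` is `ker (1 - B²)ᗮ`, and `1 - B` maps `ker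
(1 - B²)` onto `ker (1 + B)`. So the condition on `f` says that `f ⊥ ker (1 + T_i)` for every `i`
(`one_sub_apply_mem_closure_range_iff`), and the claim becomes `(ker P_n)ᗮ = ⋂ ker (1 + T_i)ᗮ`. It
is proved for the sum `P_J` of the `T_σ` over any parabolic subgroup `W_J`
(`BraidFamily.orthKer_eq`).

One inclusion is a cancellation: if `T_i g = -g` with `i ∈ J`, the terms of `σ` and `σ s_i` in `P_J
g` add up to zero.

The other goes by induction on `J` and reduces to `BraidFamily.eq_zero_of_mem_ker`: a vector `f` of
the intersection with `P_J f = 0` vanishes. For `K ⊂ J` let `V_K` be the sum over the minimal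
representatives of the cosets of `W_K` in `W_J`, so that `P_J = V_K P_K`. Taking adjoints, `P_K V_K*
f = 0`, and the induction hypothesis for `K` gives `⟪f, V_K f⟫ = 0`. Solomon's formula says `∑
(-1)^|K| V_K = T_τ` with `τ` the longest element of `W_J`, and `V_J = 1`; hence `‖f‖² = |⟪f, T_τ
f⟫|`, so `‖f‖ ≤ ‖T_τ f‖`. Any `T_i` with `i ∈ J` can be made to act first in `T_τ`, so the
contraction `T_i` preserves `‖f‖`. With `f ⊥ ker (1 + T_i)` this forces `T_i f = f`, and then `0 =
P_J f = |W_J| f`.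

The braid relations make `T_σ` independent of the reduced word (`BraidFamily.prod_eq`). It remains
to check that the amplifications `T_i` are self-adjoint contractions with braid relations. -/

namespace HilbertTensor

/-! ### Inversions and reduced words in the symmetric group. -/

section Combinatorics

variable {n : ℕ}

/-- The smaller of the two points moved by `adj n i`. -/
def lo (i : Fin (n - 1)) : Fin n := ⟨i, by omega⟩

/-- The larger of the two points moved by `adj n i`. -/
def hi (i : Fin (n - 1)) : Fin n := ⟨i + 1, by omega⟩

@[simp] theorem val_lo (i : Fin (n - 1)) : (lo i : ℕ) = i := rfl
@[simp] theorem val_hi (i : Fin (n - 1)) : (hi i : ℕ) = i + 1 := rfl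

theorem lo_lt_hi (i : Fin (n - 1)) : lo i < hi i := by simp [Fin.lt_def]

@[simp] theorem adj_lo (i : Fin (n - 1)) : adj n i (lo i) = hi i := Equiv.swap_apply_left _ _

@[simp] theorem adj_hi (i : Fin (n - 1)) : adj n i (hi i) = lo i := Equiv.swap_apply_right _ _

theorem adj_of_ne {i : Fin (n - 1)} {a : Fin n} (h1 : a ≠ lo i) (h2 : a ≠ hi i) :
    adj n i a = a := Equiv.swap_apply_of_ne_of_ne h1 h2

@[simp] theorem adj_mul_self (i : Fin (n - 1)) : adj n i * adj n i = 1 := Equiv.swap_mul_self _ _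

@[simp] theorem adj_adj (i : Fin (n - 1)) (a : Fin n) : adj n i (adj n i a) = a :=
  DFunLike.congr_fun (adj_mul_self i) a

@[simp] theorem mul_adj_mul_adj (σ : Equiv.Perm (Fin n)) (i : Fin (n - 1)) :
    σ * adj n i * adj n i = σ := by rw [mul_assoc, adj_mul_self, mul_one]

theorem val_adj (i : Fin (n - 1)) (a : Fin n) :
    (adj n i a : ℕ) =
      if (a : ℕ) = i then (i : ℕ) + 1 else if (a : ℕ) = i + 1 then (i : ℕ) else a := by
  split_ifs with h1 h2
  · obtain rfl : a = lo i := Fin.ext h1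
    simp
  · obtain rfl : a = hi i := Fin.ext h2
    simp
  · rw [adj_of_ne (fun h => h1 (by simp [h])) (fun h => h2 (by simp [h]))]

theorem adj_lt_adj {i : Fin (n - 1)} {a b : Fin n} (hab : a < b) (h : ¬(a = lo i ∧ b = hi i)) :
    adj n i a < adj n i b := by
  simp only [Fin.lt_def, Fin.ext_iff, val_lo, val_hi, val_adj] at *
  split_ifs <;> omega

/-- A transitive relation that holds between the values at neighbouring points of an interval
holds between the values at its end points. -/
theorem rel_of_rel_lo_hi {r : Fin n → Fin n → Prop} [IsTrans (Fin n) r] (g : Fin n → Fin n)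
    {a b : Fin n} (hab : a < b)
    (h : ∀ i : Fin (n - 1), a ≤ lo i → hi i ≤ b → r (g (lo i)) (g (hi i))) : r (g a) (g b) := by
  obtain ⟨b, hb⟩ := b
  induction b with
  | zero => simp [Fin.lt_def] at hab
  | succ m ih =>
    have hs : r (g ⟨m, by omega⟩) (g ⟨m + 1, hb⟩) :=
      h ⟨m, by omega⟩ (by simp [Fin.lt_def, Fin.le_def] at *; omega) le_rfl
    rcases lt_or_ge a ⟨m, by omega⟩ with h1 | h1
    · refine _root_.trans (ih (by omega) h1 fun i h2 h3 => h i h2 (h3.trans ?_)) hs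
      simp [Fin.le_def]
    · have : a = ⟨m, by omega⟩ := by
        simp [Fin.lt_def, Fin.le_def, Fin.ext_iff] at *; omega
      rwa [this]

theorem eq_one_of_no_descent {σ : Equiv.Perm (Fin n)} (h : ∀ i, σ (lo i) < σ (hi i)) : σ = 1 := by
  have hm : StrictMono σ := fun a b hab =>
    rel_of_rel_lo_hi (r := (· < ·)) σ hab fun i _ _ => h i
  have : hm.orderIsoOfSurjective σ σ.surjective = OrderIso.refl (Fin n) := Subsingleton.elim _ _
  ext a
  exact congrArg Fin.val (DFunLike.congr_fun this a)

theorem lt_or_gt_lo_hi (σ : Equiv.Perm (Fin n)) (i : Fin (n - 1)) :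
    σ (lo i) < σ (hi i) ∨ σ (hi i) < σ (lo i) :=
  lt_or_gt_of_ne (σ.injective.ne (lo_lt_hi i).ne)

/-- The inversions of a permutation. -/
def inversions (σ : Equiv.Perm (Fin n)) : Finset (Fin n × Fin n) :=
  {p | p.1 < p.2 ∧ σ p.2 < σ p.1}

theorem mem_inversions {σ : Equiv.Perm (Fin n)} {a b : Fin n} :
    (a, b) ∈ inversions σ ↔ a < b ∧ σ b < σ a := by
  simp [inversions]

/-- The number of inversions of a permutation. -/
def invCount (σ : Equiv.Perm (Fin n)) : ℕ := (inversions σ).card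

/-- Applying `adj n i` to both entries carries the inversions of `σ` to those of `σ * adj n i`,
except for the one new inversion `(lo i, hi i)`. -/
theorem invCount_mul_adj {σ : Equiv.Perm (Fin n)} {i : Fin (n - 1)} (h : σ (lo i) < σ (hi i)) :
    invCount (σ * adj n i) = invCount σ + 1 := by
  have hne : (lo i, hi i) ∉
      (inversions σ).map ((adj n i).prodCongr (adj n i)).toEmbedding := by
    simp only [Finset.mem_map, mem_inversions, not_exists, not_and, Prod.forall,
      Equiv.coe_toEmbedding, Equiv.prodCongr_apply, Prod.map_apply,
      Prod.mk.injEq]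
    intro a b hab ha hb
    replace hab := hab.1
    rw [← adj_adj i a, ← adj_adj i b, ha, hb, adj_lo, adj_hi] at hab
    exact (lo_lt_hi i).not_gt hab
  rw [invCount, invCount, ← Finset.card_map (s := inversions σ)
    ((adj n i).prodCongr (adj n i)).toEmbedding, ← Finset.card_cons hne]
  congr 1
  ext ⟨a, b⟩
  simp only [Finset.mem_cons, Finset.mem_map, mem_inversions, Prod.exists,
    Equiv.coe_toEmbedding, Equiv.prodCongr_apply, Prod.map_apply,
    Prod.mk.injEq, Equiv.Perm.mul_apply]
  constructor
  · rintro ⟨hab, hσ⟩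
    by_cases hc : a = lo i ∧ b = hi i
    · exact Or.inl hc
    · exact Or.inr ⟨_, _, ⟨adj_lt_adj hab hc, hσ⟩, adj_adj _ _, adj_adj _ _⟩
  · rintro (⟨rfl, rfl⟩ | ⟨c, d, ⟨hcd, hσ⟩, rfl, rfl⟩)
    · exact ⟨lo_lt_hi i, by simpa using h⟩
    · refine ⟨adj_lt_adj hcd ?_, by simpa using hσ⟩
      rintro ⟨rfl, rfl⟩
      exact hσ.not_gt h

theorem invCount_of_descent {σ : Equiv.Perm (Fin n)} {i : Fin (n - 1)} (h : σ (hi i) < σ (lo i)) :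
    invCount σ = invCount (σ * adj n i) + 1 := by
  rw [← invCount_mul_adj (σ := σ * adj n i) (i := i) (by simpa using h), mul_adj_mul_adj]

theorem invCount_mul_adj_le (σ : Equiv.Perm (Fin n)) (i : Fin (n - 1)) :
    invCount (σ * adj n i) ≤ invCount σ + 1 := by
  rcases lt_or_gt_lo_hi σ i with h | h
  · exact (invCount_mul_adj h).le
  · have := invCount_of_descent h
    omega

@[simp] theorem invCount_one : invCount (1 : Equiv.Perm (Fin n)) = 0 := by
  simp only [invCount, inversions, Finset.card_eq_zero, Finset.filter_eq_empty_iff]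
  exact fun p _ h => h.1.not_gt h.2

theorem invCount_prod_le (w : List (Fin (n - 1))) :
    invCount (w.map (adj n)).prod ≤ w.length := by
  induction w using List.reverseRecOn with
  | nil => simp
  | append_singleton w i ih =>
    have := invCount_mul_adj_le (w.map (adj n)).prod i
    simp
    omega

/-- Induction on permutations of `Fin n`, adding one inversion at a time. -/
theorem perm_induction {p : Equiv.Perm (Fin n) → Prop} (one : p 1)
    (mul_adj : ∀ σ i, σ (lo i) < σ (hi i) → p σ → p (σ * adj n i)) (σ : Equiv.Perm (Fin n)) :
    p σ := by
  induction hm : invCount σ using Nat.strong_induction_on generalizing σ with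
  | _ m ih =>
    by_cases hd : ∀ i, σ (lo i) < σ (hi i)
    · rwa [eq_one_of_no_descent hd]
    · push Not at hd
      obtain ⟨i, hi'⟩ := hd
      have hlt := (lt_or_gt_lo_hi σ i).resolve_left hi'.not_gt
      have := mul_adj (σ * adj n i) i (by simpa using hlt)
        (ih _ (by have := invCount_of_descent hlt; omega) _ rfl)
      rwa [mul_adj_mul_adj] at this

theorem exists_word_length_eq_invCount (σ : Equiv.Perm (Fin n)) :
    ∃ w : List (Fin (n - 1)), (w.map (adj n)).prod = σ ∧ w.length = invCount σ := by
  induction σ using perm_induction with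
  | one => exact ⟨[], by simp⟩
  | mul_adj σ i h ih =>
    obtain ⟨w, hw, hl⟩ := ih
    exact ⟨w ++ [i], by simp [hw], by simp [hl, invCount_mul_adj h]⟩

/-- One letter adds at most one inversion, and removing descents produces a word with exactly as
many letters as inversions. Minimality of a word thus becomes a count. -/
theorem isReducedWord_iff {σ : Equiv.Perm (Fin n)} {w : List (Fin (n - 1))} :
    IsReducedWord σ w ↔ (w.map (adj n)).prod = σ ∧ w.length = invCount σ := by
  constructor
  · rintro ⟨h1, h2⟩
    obtain ⟨w', h3, h4⟩ := exists_word_length_eq_invCount σ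
    refine ⟨h1, le_antisymm ((h2 w' h3).trans h4.le) ?_⟩
    rw [← h1]
    exact invCount_prod_le w
  · rintro ⟨h1, h2⟩
    refine ⟨h1, fun w' hw' => ?_⟩
    rw [h2, ← hw']
    exact invCount_prod_le w'

theorem adj_braid {i j : Fin (n - 1)} (h : (i : ℕ) + 1 = j) :
    adj n i * adj n j * adj n i = adj n j * adj n i * adj n j := by
  ext a
  simp only [Equiv.Perm.mul_apply, val_adj, ← h]
  generalize (a : ℕ) = x
  obtain rfl | rfl | rfl | ⟨h1, h2, h3⟩ : x = i ∨ x = i + 1 ∨ x = i + 1 + 1 ∨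
      x ≠ i ∧ x ≠ i + 1 ∧ x ≠ i + 1 + 1 := by omega
  all_goals grind

theorem adj_comm {i j : Fin (n - 1)} (h : (i : ℕ) + 1 < j) :
    adj n i * adj n j = adj n j * adj n i := by
  ext a
  simp only [Equiv.Perm.mul_apply, val_adj]
  split_ifs <;> omega

end Combinatorics

/-! ### Matsumoto's theorem and products along reduced words. -/

section Words

variable {n : ℕ} {M : Type*} [Monoid M]

/-- The braid relations for a family of elements of a monoid. -/
structure BraidFamily (t : Fin (n - 1) → M) : Prop where
  braid : ∀ i j : Fin (n - 1), (i : ℕ) + 1 = j → t i * t j * t i = t j * t i * t j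
  comm : ∀ i j : Fin (n - 1), (i : ℕ) + 1 < j → t i * t j = t j * t i

/-- If the last letter were an ascent of `σ`, then `σ * adj n i` would have more inversions than the
word `u` has letters. -/
theorem descent_of_reduced_concat {σ : Equiv.Perm (Fin n)} {u : List (Fin (n - 1))}
    {i : Fin (n - 1)} (h : ((u ++ [i]).map (adj n)).prod = σ) (hl : (u ++ [i]).length = invCount σ) :
    (u.map (adj n)).prod = σ * adj n i ∧ σ (hi i) < σ (lo i) ∧
      u.length = invCount (σ * adj n i) := by
  have h1 : (u.map (adj n)).prod = σ * adj n i := by simp [← h]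
  have h2 := invCount_prod_le u
  rw [h1] at h2
  simp only [List.length_append, List.length_singleton] at hl
  have h3 : σ (hi i) < σ (lo i) := by
    refine (lt_or_gt_lo_hi σ i).resolve_left fun h3 => ?_
    have := invCount_mul_adj h3
    omega
  exact ⟨h1, h3, by have := invCount_of_descent h3; omega⟩

/-- Matsumoto's theorem for the symmetric group: in a monoid with braid relations, the product
along a reduced word depends only on the permutation. -/
theorem BraidFamily.prod_eq {t : Fin (n - 1) → M} (ht : BraidFamily t) {σ : Equiv.Perm (Fin n)}
    {w w' : List (Fin (n - 1))} (hw : (w.map (adj n)).prod = σ) (hl : w.length = invCount σ)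
    (hw' : (w'.map (adj n)).prod = σ) (hl' : w'.length = invCount σ) :
    (w.map t).prod = (w'.map t).prod := by
  induction hm : invCount σ generalizing σ w w' with
  | zero =>
    rw [hm, List.length_eq_zero_iff] at hl hl'
    rw [hl, hl']
  | succ m ih =>
    -- Words with different last letters; by symmetry `i < j`. Both letters are descents of `σ`.
    have key : ∀ (i j : Fin (n - 1)) (u u' : List (Fin (n - 1))), (i : ℕ) < j →
        ((u ++ [i]).map (adj n)).prod = σ → (u ++ [i]).length = invCount σ →
        ((u' ++ [j]).map (adj n)).prod = σ → (u' ++ [j]).length = invCount σ →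
        ((u ++ [i]).map t).prod = ((u' ++ [j]).map t).prod := by
      intro i j u u' hij hu hul hu' hul'
      obtain ⟨hu, hi1, hul⟩ := descent_of_reduced_concat hu hul
      obtain ⟨hu', hj1, hul'⟩ := descent_of_reduced_concat hu' hul'
      have ci := invCount_of_descent hi1
      have cj := invCount_of_descent hj1
      -- If `j = i + 1`, then `σ` is decreasing on three consecutive points, so it has reduced words
      -- `x i j i` and `x j i j`. The induction hypothesis replaces `u` by `x i j` and `u'` by `x j
      -- i`, and one braid relation joins them. Otherwise the words are `x j i` and `x i j`, joined
      -- by commutation.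
      rcases (Nat.succ_le_of_lt hij).eq_or_lt with hij | hij
      · have hlj : lo j = hi i := Fin.ext (by simpa using hij.symm)
        have e1 : adj n i (hi j) = hi j := adj_of_ne (by simp [Fin.ext_iff]; omega)
          (by simp [Fin.ext_iff]; omega)
        have e2 : adj n j (lo i) = lo i := adj_of_ne (by simp [Fin.ext_iff]; omega)
          (by simp [Fin.ext_iff]; omega)
        have e3 : adj n j (hi i) = hi j := by rw [← hlj, adj_lo]
        have c1 := invCount_of_descent (σ := σ * adj n i) (i := j)
          (by simp only [Equiv.Perm.mul_apply, e1, hlj, adj_hi]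
              rw [hlj] at hj1; exact hj1.trans hi1)
        have c2 := invCount_of_descent (σ := σ * adj n i * adj n j) (i := i)
          (by simp only [Equiv.Perm.mul_apply, e1, e2, e3, adj_lo]
              rwa [hlj] at hj1)
        obtain ⟨x, hx, hxl⟩ := exists_word_length_eq_invCount (σ * adj n i * adj n j * adj n i)
        have r1 := ih hu hul (w' := x ++ [i, j]) (by simp [hx, ← mul_assoc])
          (by simp [hxl]; omega) (by omega)
        have hx' : (x.map (adj n)).prod = σ * adj n j * adj n i * adj n j := by
          rw [hx, mul_assoc, mul_assoc, ← mul_assoc (adj n i), adj_braid hij]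
          simp only [mul_assoc]
        have r2 := ih hu' hul' (w' := x ++ [j, i]) (by simp [hx', ← mul_assoc])
          (by simp [hxl]; omega) (by omega)
        simp only [List.map_append, List.prod_append, List.map_cons, List.map_nil, List.prod_cons,
          List.prod_nil, mul_one] at r1 r2 ⊢
        rw [r1, r2, mul_assoc, mul_assoc, ← mul_assoc (t i), ht.braid i j hij]
        simp only [mul_assoc]
      · have e1 : adj n i (hi j) = hi j := adj_of_ne (by simp [Fin.ext_iff]; omega)
          (by simp [Fin.ext_iff]; omega)
        have e2 : adj n i (lo j) = lo j := adj_of_ne (by simp [Fin.ext_iff]; omega)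
          (by simp [Fin.ext_iff]; omega)
        have c1 := invCount_of_descent (σ := σ * adj n i) (i := j)
          (by simpa only [Equiv.Perm.mul_apply, e1, e2] using hj1)
        obtain ⟨x, hx, hxl⟩ := exists_word_length_eq_invCount (σ * adj n i * adj n j)
        have r1 := ih hu hul (w' := x ++ [j]) (by simp [hx]) (by simp [hxl]; omega) (by omega)
        have hx' : (x.map (adj n)).prod = σ * adj n j * adj n i := by
          rw [hx, mul_assoc, mul_assoc, adj_comm hij]
        have r2 := ih hu' hul' (w' := x ++ [i]) (by simp [hx']) (by simp [hxl]; omega) (by omega)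
        simp only [List.map_append, List.prod_append, List.map_cons, List.map_nil, List.prod_cons,
          List.prod_nil, mul_one] at r1 r2 ⊢
        rw [r1, r2, mul_assoc, mul_assoc, ht.comm i j hij]
    rcases List.eq_nil_or_concat' w with rfl | ⟨u, i, rfl⟩
    · simp [hm] at hl
    rcases List.eq_nil_or_concat' w' with rfl | ⟨u', j, rfl⟩
    · simp [hm] at hl'
    rcases lt_trichotomy (i : ℕ) j with h | h | h
    · exact key i j u u' h hw hl hw' hl'
    · obtain rfl : i = j := Fin.ext h
      obtain ⟨hu, hi1, hul⟩ := descent_of_reduced_concat hw hl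
      obtain ⟨hu', -, hul'⟩ := descent_of_reduced_concat hw' hl'
      have ci := invCount_of_descent hi1
      simp only [List.map_append, List.prod_append]
      rw [ih hu hul hu' hul' (by omega)]
    · exact (key j i u' u h hw' hl' hw hl).symm

/-- The product of the `t i` along some reduced word of `σ`. -/
noncomputable def reducedProd (t : Fin (n - 1) → M) (σ : Equiv.Perm (Fin n)) : M :=
  ((exists_isReducedWord σ).choose.map t).prod

theorem BraidFamily.reducedProd_eq {t : Fin (n - 1) → M} (ht : BraidFamily t)
    {σ : Equiv.Perm (Fin n)} {w : List (Fin (n - 1))} (hw : IsReducedWord σ w) :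
    reducedProd t σ = (w.map t).prod := by
  have h := isReducedWord_iff.1 (exists_isReducedWord σ).choose_spec
  have h' := isReducedWord_iff.1 hw
  exact ht.prod_eq h.1 h.2 h'.1 h'.2

theorem BraidFamily.reducedProd_one {t : Fin (n - 1) → M} (ht : BraidFamily t) :
    reducedProd t 1 = 1 := by
  rw [ht.reducedProd_eq (w := []) (isReducedWord_iff.2 (by simp))]
  simp

theorem BraidFamily.reducedProd_mul_adj {t : Fin (n - 1) → M} (ht : BraidFamily t)
    {σ : Equiv.Perm (Fin n)} {i : Fin (n - 1)} (h : σ (lo i) < σ (hi i)) :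
    reducedProd t (σ * adj n i) = reducedProd t σ * t i := by
  obtain ⟨w, hw⟩ := exists_isReducedWord σ
  have hw' := isReducedWord_iff.1 hw
  rw [ht.reducedProd_eq hw, ht.reducedProd_eq (w := w ++ [i])
    (isReducedWord_iff.2 (by simp [hw'.1, hw'.2, invCount_mul_adj h]))]
  simp

theorem BraidFamily.reducedProd_of_descent {t : Fin (n - 1) → M} (ht : BraidFamily t)
    {σ : Equiv.Perm (Fin n)} {i : Fin (n - 1)} (h : σ (hi i) < σ (lo i)) :
    reducedProd t σ = reducedProd t (σ * adj n i) * t i := by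
  rw [← ht.reducedProd_mul_adj (by simpa using h), mul_adj_mul_adj]

theorem prod_map_adj_reverse (w : List (Fin (n - 1))) :
    (w.reverse.map (adj n)).prod = (w.map (adj n)).prod⁻¹ := by
  induction w with
  | nil => simp
  | cons i w ih =>
    have : (adj n i)⁻¹ = adj n i := inv_eq_of_mul_eq_one_right (adj_mul_self i)
    rw [List.reverse_cons, List.map_append, List.prod_append, ih]
    simp [this]

theorem IsReducedWord.reverse {σ : Equiv.Perm (Fin n)} {w : List (Fin (n - 1))}
    (h : IsReducedWord σ w) : IsReducedWord σ⁻¹ w.reverse := by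
  refine ⟨by rw [prod_map_adj_reverse, h.1], fun w' hw' => ?_⟩
  have := h.2 w'.reverse (by rw [prod_map_adj_reverse, hw', inv_inv])
  simpa using this

/-- The adjoint reverses the product, and a reversed reduced word of `σ` is a reduced word of `σ⁻¹`.
-/
theorem BraidFamily.star_reducedProd [StarMul M] {t : Fin (n - 1) → M} (ht : BraidFamily t)
    (hs : ∀ i, IsSelfAdjoint (t i)) (σ : Equiv.Perm (Fin n)) :
    star (reducedProd t σ) = reducedProd t σ⁻¹ := by
  obtain ⟨w, hw⟩ := exists_isReducedWord σ
  rw [ht.reducedProd_eq hw, ht.reducedProd_eq hw.reverse]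
  clear hw
  induction w with
  | nil => simp
  | cons i w ih => simp [ih, (hs i).star_eq]

end Words

/-! ### Parabolic subgroups, minimal coset representatives and Solomon's formula. -/

section Parabolic

variable {n : ℕ}

/-- The parabolic subgroup of the permutations of `Fin n` generated by the `adj n i`, `i ∈ J`:
the permutations that map `{0, …, k}` to itself for every `k ∉ J`. -/
def parabolic (J : Finset (Fin (n - 1))) : Subgroup (Equiv.Perm (Fin n)) where
  carrier := {σ | ∀ k ∉ J, ∀ a, σ a ≤ lo k ↔ a ≤ lo k}
  one_mem' := fun _ _ _ => Iff.rfl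
  mul_mem' := fun hσ hτ k hk a => (hσ k hk _).trans (hτ k hk a)
  inv_mem' := fun {σ} hσ k hk a => by simpa using (hσ k hk (σ⁻¹ a)).symm

theorem parabolic_mono {K J : Finset (Fin (n - 1))} (h : K ⊆ J) : parabolic K ≤ parabolic J :=
  fun _ hσ k hk => hσ k fun hk' => hk (h hk')

@[simp] theorem parabolic_univ : parabolic (Finset.univ : Finset (Fin (n - 1))) = ⊤ :=
  eq_top_iff.2 fun _ _ k hk => (hk (Finset.mem_univ k)).elim

theorem adj_mem_parabolic {J : Finset (Fin (n - 1))} {i : Fin (n - 1)} (hi : i ∈ J) :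
    adj n i ∈ parabolic J := by
  intro k hk a
  have : (k : ℕ) ≠ i := fun h => hk (Fin.ext h ▸ hi)
  simp only [Fin.le_def, val_adj, val_lo]
  split_ifs <;> omega

theorem lt_of_mem_parabolic {J : Finset (Fin (n - 1))} {σ : Equiv.Perm (Fin n)}
    (hσ : σ ∈ parabolic J) {k : Fin (n - 1)} (hk : k ∉ J) : σ (lo k) < σ (hi k) :=
  ((hσ k hk _).2 le_rfl).trans_lt (not_le.1 fun h => (lo_lt_hi k).not_ge ((hσ k hk _).1 h))

theorem eq_one_of_mem_parabolic {J : Finset (Fin (n - 1))} {σ : Equiv.Perm (Fin n)}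
    (hσ : σ ∈ parabolic J) (h : ∀ k ∈ J, σ (lo k) < σ (hi k)) : σ = 1 :=
  eq_one_of_no_descent fun k => if hk : k ∈ J then h k hk else lt_of_mem_parabolic hσ hk

/-- If `σ` is monotone for `r` on the blocks of `J`, it is so on the images of neighbouring points of
a block under an element of the parabolic subgroup. -/
theorem rel_of_mem_parabolic {J : Finset (Fin (n - 1))} {r : Fin n → Fin n → Prop}
    [IsTrans (Fin n) r] {σ τ : Equiv.Perm (Fin n)} (hσ : ∀ k ∈ J, r (σ (lo k)) (σ (hi k)))
    (hτ : τ ∈ parabolic J) {k : Fin (n - 1)} (hk : k ∈ J) :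
    (τ (lo k) < τ (hi k) → r (σ (τ (lo k))) (σ (τ (hi k)))) ∧
      (τ (hi k) < τ (lo k) → r (σ (τ (hi k))) (σ (τ (lo k)))) := by
  -- A cut at `c ∉ J` does not separate `lo k` from `hi k`, since `c ≠ k`. As `τ` respects this cut,
  -- the two images lie in the same block.
  have h : ∀ c ∉ J, τ (lo k) ≤ lo c ↔ τ (hi k) ≤ lo c := by
    intro c hc
    have : (c : ℕ) ≠ k := fun h => hc (Fin.ext h ▸ hk)
    rw [hτ c hc, hτ c hc]
    simp only [Fin.le_def, val_lo, val_hi]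
    omega
  constructor <;> intro hlt <;> refine rel_of_rel_lo_hi σ hlt fun c h1 h2 => hσ c ?_ <;>
    by_contra hc
  · exact (lo_lt_hi c).not_ge (h2.trans ((h c hc).1 h1))
  · exact (lo_lt_hi c).not_ge (h2.trans ((h c hc).2 h1))

/-- `τ` permutes each block of `J` and `σ` is increasing on blocks, so `σ` does not affect the
comparison. -/
theorem mul_lt_mul_iff_of_mem_parabolic {J : Finset (Fin (n - 1))} {σ τ : Equiv.Perm (Fin n)}
    (hσ : ∀ k ∈ J, σ (lo k) < σ (hi k)) (hτ : τ ∈ parabolic J) {k : Fin (n - 1)} (hk : k ∈ J) :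
    (σ * τ) (lo k) < (σ * τ) (hi k) ↔ τ (lo k) < τ (hi k) := by
  have h := rel_of_mem_parabolic (r := (· < ·)) hσ hτ hk
  refine ⟨fun h1 => ?_, h.1⟩
  exact (lt_or_gt_lo_hi τ k).resolve_right fun h2 => h1.not_gt (h.2 h2)

/-- A parabolic subgroup has at most one element with all possible descents. -/
theorem eq_of_descents {J : Finset (Fin (n - 1))} {σ τ : Equiv.Perm (Fin n)}
    (hσ : σ ∈ parabolic J) (hτ : τ ∈ parabolic J) (hσd : ∀ k ∈ J, σ (hi k) < σ (lo k))
    (hτd : ∀ k ∈ J, τ (hi k) < τ (lo k)) : σ = τ := by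
  have hm : σ⁻¹ * τ ∈ parabolic J := mul_mem (inv_mem hσ) hτ
  have := eq_one_of_mem_parabolic hm fun k hk => by
    -- `σ` reverses the order on blocks, so a descent of `σ⁻¹ * τ` would be an ascent of `σ * (σ⁻¹ *
    -- τ) = τ`.
    refine (lt_or_gt_lo_hi _ k).resolve_right fun h => ?_
    have := (rel_of_mem_parabolic (r := (· > ·)) hσd hm hk).2 h
    simp only [← Equiv.Perm.mul_apply, mul_inv_cancel_left] at this
    exact this.not_gt (hτd k hk)
  exact inv_mul_eq_one.1 this

/-- The elements of the parabolic subgroup of `J` without descents in `K`. -/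
noncomputable def minReps (J K : Finset (Fin (n - 1))) : Finset (Equiv.Perm (Fin n)) :=
  open Classical in {σ | σ ∈ parabolic J ∧ ∀ k ∈ K, σ (lo k) < σ (hi k)}

/-- The parabolic subgroup of `J`, as a finite set. -/
noncomputable def parabolicFinset (J : Finset (Fin (n - 1))) : Finset (Equiv.Perm (Fin n)) :=
  open Classical in {σ | σ ∈ parabolic J}

@[simp] theorem mem_minReps {J K : Finset (Fin (n - 1))} {σ : Equiv.Perm (Fin n)} :
    σ ∈ minReps J K ↔ σ ∈ parabolic J ∧ ∀ k ∈ K, σ (lo k) < σ (hi k) := by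
  simp [minReps]

@[simp] theorem mem_parabolicFinset {J : Finset (Fin (n - 1))} {σ : Equiv.Perm (Fin n)} :
    σ ∈ parabolicFinset J ↔ σ ∈ parabolic J := by
  simp [parabolicFinset]

/-- Descents in `K` are stripped off on the right and collected in `u`; the process stops because
inversions decrease. -/
theorem exists_minReps_mul {J K : Finset (Fin (n - 1))} (hKJ : K ⊆ J) (σ : Equiv.Perm (Fin n))
    (hσ : σ ∈ parabolic J) : ∃ v ∈ minReps J K, ∃ u ∈ parabolicFinset K, v * u = σ := by
  induction hm : invCount σ using Nat.strong_induction_on generalizing σ with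
  | _ m ih =>
    by_cases hd : ∀ k ∈ K, σ (lo k) < σ (hi k)
    · exact ⟨σ, mem_minReps.2 ⟨hσ, hd⟩, 1, mem_parabolicFinset.2 (one_mem _), mul_one σ⟩
    · push Not at hd
      obtain ⟨k, hk, hk'⟩ := hd
      have hlt := (lt_or_gt_lo_hi σ k).resolve_left hk'.not_gt
      obtain ⟨v, hv, u, hu, he⟩ := ih _ (by have := invCount_of_descent hlt; omega) (σ * adj n k)
        (mul_mem hσ (adj_mem_parabolic (hKJ hk))) rfl
      exact ⟨v, hv, u * adj n k, mem_parabolicFinset.2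
        (mul_mem (mem_parabolicFinset.1 hu) (adj_mem_parabolic hk)), by
          rw [← mul_assoc, he, mul_adj_mul_adj]⟩

theorem minReps_mul_injective {J K : Finset (Fin (n - 1))} {v v' u u' : Equiv.Perm (Fin n)}
    (hv : v ∈ minReps J K) (hv' : v' ∈ minReps J K) (hu : u ∈ parabolic K) (hu' : u' ∈ parabolic K)
    (h : v * u = v' * u') : v = v' ∧ u = u' := by
  have hm : u' * u⁻¹ ∈ parabolic K := mul_mem hu' (inv_mem hu)
  have he : v = v' * (u' * u⁻¹) := by rw [← mul_assoc, ← h, mul_inv_cancel_right]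
  have h1 : u' * u⁻¹ = 1 := eq_one_of_mem_parabolic hm fun k hk => by
    rw [← mul_lt_mul_iff_of_mem_parabolic (mem_minReps.1 hv').2 hm hk, ← he]
    exact (mem_minReps.1 hv).2 k hk
  rw [h1, mul_one] at he
  exact ⟨he, (mul_inv_eq_one.1 h1).symm⟩

/-- Building `u` up by ascents inside `K`, each step remains an ascent after multiplication by `v`
on the left, so lengths add. -/
theorem BraidFamily.reducedProd_minReps_mul {M : Type*} [Monoid M] {t : Fin (n - 1) → M}
    (ht : BraidFamily t) {K : Finset (Fin (n - 1))} {v : Equiv.Perm (Fin n)}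
    (hv : ∀ k ∈ K, v (lo k) < v (hi k)) (u : Equiv.Perm (Fin n)) (hu : u ∈ parabolic K) :
    reducedProd t (v * u) = reducedProd t v * reducedProd t u := by
  induction u using perm_induction with
  | one => simp [ht.reducedProd_one]
  | mul_adj u i h ih =>
    have hi : i ∈ K := by
      by_contra hi
      exact h.not_gt (by simpa using lt_of_mem_parabolic hu hi)
    have hu' : u ∈ parabolic K := by
      simpa using mul_mem hu (adj_mem_parabolic hi)
    rw [ht.reducedProd_mul_adj h, ← mul_assoc, ht.reducedProd_mul_adj, ih hu', mul_assoc]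
    exact (mul_lt_mul_iff_of_mem_parabolic hv hu' hi).2 h

/-- The unique factorization `σ = v * u` is compatible with `reducedProd`. -/
theorem BraidFamily.sum_parabolic_eq_mul {R : Type*} [Semiring R] {t : Fin (n - 1) → R}
    (ht : BraidFamily t) {J K : Finset (Fin (n - 1))} (hKJ : K ⊆ J) :
    ∑ σ ∈ parabolicFinset J, reducedProd t σ =
      (∑ σ ∈ minReps J K, reducedProd t σ) * ∑ σ ∈ parabolicFinset K, reducedProd t σ := by
  rw [Finset.sum_mul_sum, ← Finset.sum_product']
  symm
  refine Finset.sum_bij (fun p _ => p.1 * p.2) ?_ ?_ ?_ ?_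
  · rintro ⟨v, u⟩ h
    simp only [Finset.mem_product, mem_minReps, mem_parabolicFinset] at h ⊢
    exact mul_mem h.1.1 (parabolic_mono hKJ h.2)
  · rintro ⟨v, u⟩ h ⟨v', u'⟩ h' he
    rw [Finset.mem_product, mem_parabolicFinset] at h h'
    exact Prod.ext_iff.2 (minReps_mul_injective h.1 h'.1 h.2 h'.2 he)
  · intro σ hσ
    obtain ⟨v, hv, u, hu, he⟩ := exists_minReps_mul hKJ σ (mem_parabolicFinset.1 hσ)
    exact ⟨(v, u), Finset.mem_product.2 ⟨hv, hu⟩, he⟩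
  · rintro ⟨v, u⟩ h
    simp only [Finset.mem_product, mem_minReps, mem_parabolicFinset] at h
    exact (ht.reducedProd_minReps_mul h.1.2 u h.2).symm

/-- Solomon's alternating sum formula: only the longest element of the parabolic subgroup remains. -/
theorem sum_powerset_minReps {R : Type*} [Ring R] (J : Finset (Fin (n - 1)))
    (f : Equiv.Perm (Fin n) → R) :
    ∑ K ∈ J.powerset, (-1 : ℤ) ^ K.card • ∑ σ ∈ minReps J K, f σ =
      ∑ σ ∈ parabolicFinset J with ∀ k ∈ J, σ (hi k) < σ (lo k), f σ := by
  classical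
  have h1 : ∀ K ∈ J.powerset, (-1 : ℤ) ^ K.card • ∑ σ ∈ minReps J K, f σ =
      ∑ σ ∈ parabolicFinset J, if K ⊆ {k ∈ J | σ (lo k) < σ (hi k)} then
        (-1 : ℤ) ^ K.card • f σ else 0 := by
    intro K hK
    rw [← Finset.sum_filter, Finset.smul_sum]
    refine Finset.sum_congr (Finset.ext fun σ => ?_) fun _ _ => rfl
    rw [Finset.mem_filter, mem_minReps, mem_parabolicFinset]
    refine and_congr_right fun _ => ⟨fun h k hk => ?_, fun h k hk => ?_⟩
    · exact Finset.mem_filter.2 ⟨Finset.mem_powerset.1 hK hk, h k hk⟩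
    · exact (Finset.mem_filter.1 (h hk)).2
  -- After exchanging the sums, `f σ` has coefficient `∑ (-1)^|K|` over all sets `K` of ascents of
  -- `σ` in `J`. This is zero unless `σ` has no ascent in `J`.
  rw [Finset.sum_congr rfl h1, Finset.sum_comm, Finset.sum_filter]
  refine Finset.sum_congr rfl fun σ _ => ?_
  have h2 : J.powerset.filter (· ⊆ {k ∈ J | σ (lo k) < σ (hi k)}) =
      Finset.powerset {k ∈ J | σ (lo k) < σ (hi k)} := by
    ext K
    simp only [Finset.mem_filter, Finset.mem_powerset]
    exact ⟨fun h => h.2, fun h => ⟨h.trans (Finset.filter_subset _ _), h⟩⟩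
  rw [← Finset.sum_filter, h2, ← Finset.sum_smul, Finset.sum_powerset_neg_one_pow_card, ite_smul,
    one_smul, zero_smul]
  refine if_congr ?_ rfl rfl
  rw [Finset.filter_eq_empty_iff]
  exact forall₂_congr fun k _ => ⟨fun h => (lt_or_gt_lo_hi σ k).resolve_left h, fun h => h.not_gt⟩

end Parabolic

/-! ### The kernel of the sum over a parabolic subgroup. -/

section Kernel

variable {n : ℕ} {X : Type*} [NormedAddCommGroup X] [InnerProductSpace ℂ X]

open scoped InnerProductSpace

/-- The sum of the `T_σ` over the parabolic subgroup of `J`. -/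
noncomputable def parabolicSum (A : Fin (n - 1) → X →L[ℂ] X) (J : Finset (Fin (n - 1))) :
    X →L[ℂ] X :=
  ∑ σ ∈ parabolicFinset J, reducedProd A σ

/-- The vectors orthogonal to `ker (1 + A i)` for every `i ∈ J`. -/
noncomputable def orthKer (A : Fin (n - 1) → X →L[ℂ] X) (J : Finset (Fin (n - 1))) :
    Submodule ℂ X :=
  ⨅ i ∈ J, (LinearMap.ker (1 + A i).toLinearMap)ᗮ

variable {A : Fin (n - 1) → X →L[ℂ] X} {J K : Finset (Fin (n - 1))}

theorem mem_orthKer {f : X} :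
    f ∈ orthKer A J ↔ ∀ i ∈ J, ∀ g, A i g = -g → ⟪g, f⟫_ℂ = 0 := by
  simp [orthKer, Submodule.mem_iInf, Submodule.mem_orthogonal, add_eq_zero_iff_eq_neg']

theorem orthKer_anti (h : K ⊆ J) : orthKer A J ≤ orthKer A K :=
  fun _ hf => mem_orthKer.2 fun i hi => mem_orthKer.1 hf i (h hi)

theorem isClosed_orthKer : IsClosed (orthKer A J : Set X) := by
  simp only [orthKer, Submodule.coe_iInf]
  exact isClosed_iInter fun i => isClosed_iInter fun _ => Submodule.isClosed_orthogonal _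

theorem norm_reducedProd_apply_le (hn : ∀ i, ‖A i‖ ≤ 1) (σ : Equiv.Perm (Fin n)) (f : X) :
    ‖reducedProd A σ f‖ ≤ ‖f‖ := by
  unfold reducedProd
  induction (exists_isReducedWord σ).choose with
  | nil => simp
  | cons i w ih =>
    rw [List.map_cons, List.prod_cons, mul_apply_eq_comp]
    exact ((A i).le_of_opNorm_le (hn i) _).trans (by simpa using ih)

/-- The involution `σ ↦ σ * adj n i` pairs terms that differ by a final factor `A i`, hence by a
sign on `g`. -/
theorem BraidFamily.parabolicSum_apply_eq_zero (hA : BraidFamily A) {i : Fin (n - 1)} (hi : i ∈ J)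
    {g : X} (hg : A i g = -g) : parabolicSum A J g = 0 := by
  rw [parabolicSum, sum_apply]
  refine Finset.sum_involution (fun σ _ => σ * adj n i) ?_ ?_ ?_ ?_
  · intro σ _
    rcases lt_or_gt_lo_hi σ i with h | h
    · rw [hA.reducedProd_mul_adj h, mul_apply_eq_comp, hg, map_neg, add_neg_cancel]
    · rw [hA.reducedProd_of_descent h, mul_apply_eq_comp, hg, map_neg, neg_add_cancel]
  · intro σ _ _ h
    have h1 : adj n i = 1 := mul_eq_left.1 h
    have h2 := adj_lo i
    rw [h1] at h2
    exact (lo_lt_hi i).ne h2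
  · intro σ hσ
    exact mem_parabolicFinset.2 (mul_mem (mem_parabolicFinset.1 hσ) (adj_mem_parabolic hi))
  · intro σ _
    exact mul_adj_mul_adj σ i

/-- A vector orthogonal to the kernel of the sum is orthogonal to every `ker (1 + A i)`. -/
theorem BraidFamily.orthogonal_ker_le (hA : BraidFamily A) :
    (LinearMap.ker (parabolicSum A J).toLinearMap)ᗮ ≤ orthKer A J := by
  intro f hf
  refine mem_orthKer.2 fun i hi g hg => ?_
  exact (Submodule.mem_orthogonal _ _).1 hf g (hA.parabolicSum_apply_eq_zero hi hg)

theorem reducedProd_apply_of_fixed (hA : BraidFamily A) {f : X} (hf : ∀ i ∈ J, A i f = f)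
    (σ : Equiv.Perm (Fin n)) (hσ : σ ∈ parabolic J) : reducedProd A σ f = f := by
  induction σ using perm_induction with
  | one => simp [hA.reducedProd_one]
  | mul_adj σ i h ih =>
    have hi : i ∈ J := by
      by_contra hi
      exact h.not_gt (by simpa using lt_of_mem_parabolic hσ hi)
    have hσ' : σ ∈ parabolic J := by simpa using mul_mem hσ (adj_mem_parabolic hi)
    rw [hA.reducedProd_mul_adj h, mul_apply_eq_comp, hf i hi, ih hσ']

/-- On such a vector the sum acts as multiplication by the order of the parabolic subgroup. -/
theorem eq_zero_of_fixed (hA : BraidFamily A) {f : X} (hf : ∀ i ∈ J, A i f = f)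
    (h : parabolicSum A J f = 0) : f = 0 := by
  rw [parabolicSum, sum_apply,
    Finset.sum_congr rfl fun σ hσ => reducedProd_apply_of_fixed hA hf σ (mem_parabolicFinset.1 hσ),
    Finset.sum_const, ← Nat.cast_smul_eq_nsmul ℂ, smul_eq_zero, Nat.cast_eq_zero,
    Finset.card_eq_zero] at h
  refine h.resolve_left (Finset.Nonempty.ne_empty ⟨1, mem_parabolicFinset.2 (one_mem _)⟩)

variable [CompleteSpace X]

theorem BraidFamily.isSelfAdjoint_parabolicSum (hA : BraidFamily A)
    (hs : ∀ i, IsSelfAdjoint (A i)) : IsSelfAdjoint (parabolicSum A J) := by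
  rw [IsSelfAdjoint, parabolicSum, star_sum]
  simp only [hA.star_reducedProd hs]
  exact Finset.sum_equiv (Equiv.inv _) (by simp) fun _ _ => rfl

theorem inner_apply_of_isSelfAdjoint {B : X →L[ℂ] X} (hB : IsSelfAdjoint B) (f g : X) :
    ⟪B f, g⟫_ℂ = ⟪f, B g⟫_ℂ := by
  rw [← ContinuousLinearMap.adjoint_inner_left, ← ContinuousLinearMap.star_eq_adjoint, hB.star_eq]

/-- A self-adjoint contraction `A i` that preserves the norm of a vector orthogonal to `ker (1 + A i)`
fixes this vector. -/
theorem apply_eq_self_of_norm_eq (hs : ∀ i, IsSelfAdjoint (A i)) (hn : ∀ i, ‖A i‖ ≤ 1)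
    {i : Fin (n - 1)} {f : X} (hf : ∀ g, A i g = -g → ⟪g, f⟫_ℂ = 0) (h : ‖f‖ ≤ ‖A i f‖) :
    A i f = f := by
  have hle : ∀ g, ‖A i g‖ ≤ ‖g‖ := fun g => by simpa using (A i).le_of_opNorm_le (hn i) g
  have h1 : A i (A i f) = f := by
    have e : ⟪A i (A i f), f⟫_ℂ = ⟪A i f, A i f⟫_ℂ := inner_apply_of_isSelfAdjoint (hs i) _ _
    -- Expanding the square gives `‖A²f‖² - 2‖Af‖² + ‖f‖²`, with `‖A²f‖ ≤ ‖f‖ ≤ ‖Af‖`.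
    have h2 : ‖A i (A i f) - f‖ ^ 2 ≤ 0 := by
      rw [norm_sub_sq (𝕜 := ℂ), e, inner_self_eq_norm_sq]
      have h3 := (hle (A i f)).trans (hle f)
      have h4 := pow_le_pow_left₀ (norm_nonneg _) h3 2
      have h5 := pow_le_pow_left₀ (norm_nonneg _) h 2
      linarith
    exact sub_eq_zero.1 (norm_eq_zero.1 (pow_eq_zero_iff two_ne_zero |>.1
      (le_antisymm h2 (sq_nonneg _))))
  have h2 : A i (f - A i f) = -(f - A i f) := by rw [map_sub, h1, neg_sub]
  have h3 := hf _ h2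
  have h4 : ⟪f - A i f, A i f⟫_ℂ = 0 := by
    rw [← inner_apply_of_isSelfAdjoint (hs i), h2, inner_neg_left, h3, neg_zero]
  have h5 : ⟪f - A i f, f - A i f⟫_ℂ = 0 := by rw [inner_sub_right, h3, h4, sub_zero]
  exact (sub_eq_zero.1 (inner_self_eq_zero.1 h5)).symm

/-- If the claim holds for the proper subsets of `J`, the alternating sum formula shows that the
kernel of the sum over `J` meets `orthKer A J` trivially. -/
theorem BraidFamily.eq_zero_of_mem_ker (hA : BraidFamily A) (hs : ∀ i, IsSelfAdjoint (A i))
    (hn : ∀ i, ‖A i‖ ≤ 1)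
    (ih : ∀ K ⊂ J, orthKer A K ≤ (LinearMap.ker (parabolicSum A K).toLinearMap)ᗮ)
    {f : X} (hf : f ∈ orthKer A J) (h : parabolicSum A J f = 0) : f = 0 := by
  -- The adjoint of the coset sum maps `f` into `ker P_K`, because `P_J = P_K V_K*` by
  -- self-adjointness of both sums; `f` is orthogonal to that kernel.
  have h1 : ∀ K ⊂ J, ⟪f, (∑ σ ∈ minReps J K, reducedProd A σ) f⟫_ℂ = 0 := by
    intro K hK
    rw [← ContinuousLinearMap.adjoint_inner_left, ← ContinuousLinearMap.star_eq_adjoint]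
    refine (Submodule.mem_orthogonal _ _).1 (ih K hK (orthKer_anti hK.1 hf)) _ ?_
    have h2 : parabolicSum A J = _ := hA.sum_parabolic_eq_mul hK.1
    have h3 := congrArg star h2
    rw [(hA.isSelfAdjoint_parabolicSum hs).star_eq, star_mul] at h3
    change parabolicSum A K _ = 0
    rw [← (hA.isSelfAdjoint_parabolicSum hs (J := K)).star_eq, ← mul_apply_eq_comp]
    change (star (∑ σ ∈ parabolicFinset K, reducedProd A σ) * _) f = 0
    rw [← h3, h]
  have hJ : minReps J J = {1} := by
    ext σ
    rw [mem_minReps, Finset.mem_singleton]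
    refine ⟨fun h => eq_one_of_mem_parabolic h.1 h.2, ?_⟩
    rintro rfl
    exact ⟨one_mem _, fun k _ => lo_lt_hi k⟩
  have h2 := congrArg (fun B : X →L[ℂ] X => ⟪f, B f⟫_ℂ) (sum_powerset_minReps J (reducedProd A))
  simp only [sum_apply, inner_sum] at h2
  rw [Finset.sum_eq_single_of_mem J (Finset.mem_powerset_self J), hJ, Finset.sum_singleton,
    hA.reducedProd_one] at h2
  swap
  · intro K hK hne
    have h3 := h1 K ((Finset.mem_powerset.1 hK).ssubset_of_ne hne)
    rw [smul_apply, ← Int.cast_smul_eq_zsmul ℂ, inner_smul_right, h3, mul_zero]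
  have h3 : ‖f‖ ^ 2 = ‖⟪f, ((-1 : ℤ) ^ J.card • (1 : X →L[ℂ] X)) f⟫_ℂ‖ := by
    rw [smul_apply, ← Int.cast_smul_eq_zsmul ℂ, inner_smul_right, norm_mul]
    simp
  rw [h2] at h3
  by_contra hf0
  have hpos : 0 < ‖f‖ := norm_pos_iff.2 hf0
  -- Existence of the longest element needs no separate argument: an empty sum would give `‖f‖² =
  -- 0`.
  obtain ⟨τ, hτ⟩ : ({σ ∈ parabolicFinset J | ∀ k ∈ J, σ (hi k) < σ (lo k)}).Nonempty := by
    rw [Finset.nonempty_iff_ne_empty]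
    intro he
    rw [he] at h3
    simp at h3
    exact hf0 h3
  have hτ' := Finset.mem_filter.1 hτ
  rw [Finset.sum_eq_single_of_mem τ hτ] at h3
  swap
  · intro σ hσ hne
    have hσ' := Finset.mem_filter.1 hσ
    exact (hne (eq_of_descents (mem_parabolicFinset.1 hσ'.1) (mem_parabolicFinset.1 hτ'.1)
      hσ'.2 hτ'.2)).elim
  have h4 : ‖f‖ ≤ ‖reducedProd A τ f‖ := by
    have := norm_inner_le_norm (𝕜 := ℂ) f (reducedProd A τ f)
    rw [← h3, sq] at this
    exact le_of_mul_le_mul_left this hpos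
  refine hf0 (eq_zero_of_fixed hA (J := J) (fun i hi => ?_) h)
  refine apply_eq_self_of_norm_eq hs hn (mem_orthKer.1 hf i hi) (h4.trans ?_)
  -- Since `i` is a descent of `τ`, the factor `A i` acts first and a contraction follows.
  rw [hA.reducedProd_of_descent (hτ'.2 i hi), mul_apply_eq_comp]
  exact norm_reducedProd_apply_le hn _ _

/-- For self-adjoint contractions with braid relations, the orthogonal complement of
`ker (∑ σ, T_σ)` is the intersection of the orthogonal complements of the `ker (1 + A i)`. -/
theorem BraidFamily.orthKer_eq (hA : BraidFamily A) (hs : ∀ i, IsSelfAdjoint (A i))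
    (hn : ∀ i, ‖A i‖ ≤ 1) (J : Finset (Fin (n - 1))) :
    orthKer A J = (LinearMap.ker (parabolicSum A J).toLinearMap)ᗮ := by
  refine le_antisymm ?_ hA.orthogonal_ker_le
  induction J using Finset.strongInduction with
  | H J ih =>
    have hcl : IsClosed (LinearMap.ker (parabolicSum A J).toLinearMap : Set X) :=
      (parabolicSum A J).isClosed_ker
    have hle : (orthKer A J)ᗮ ≤ LinearMap.ker (parabolicSum A J).toLinearMap := by
      have := Submodule.orthogonal_le (hA.orthogonal_ker_le (J := J))
      rwa [Submodule.orthogonal_orthogonal_eq_closure, hcl.submodule_topologicalClosure_eq] at this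
    have : CompleteSpace (orthKer A J) := isClosed_orthKer.completeSpace_coe
    intro f hf
    rw [Submodule.mem_orthogonal]
    intro g hg
    -- The component `z` is already killed by `P_J`, so `y` lies in both `orthKer A J` and `ker
    -- P_J`.
    obtain ⟨y, hy, z, hz, rfl⟩ := (orthKer A J).exists_add_mem_mem_orthogonal g
    have hy0 : y = 0 := hA.eq_zero_of_mem_ker hs hn ih hy
      (by simpa using sub_mem hg (hle hz))
    rw [hy0, zero_add]
    exact (Submodule.mem_orthogonal' _ _).1 hz f hf

/-- For a self-adjoint `B`, the vector `(1 - B) f` lies in the closure of the range of `1 - B²` if and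
only if `f` is orthogonal to `ker (1 + B)`. -/
theorem one_sub_apply_mem_closure_range_iff {B : X →L[ℂ] X} (hB : IsSelfAdjoint B) (f : X) :
    (1 - B) f ∈ closure (Set.range (1 - B ^ 2 : X →L[ℂ] X)) ↔ ∀ g, B g = -g → ⟪g, f⟫_ℂ = 0 := by
  have hsa : IsSelfAdjoint (1 - B ^ 2) := (IsSelfAdjoint.one _).sub (hB.pow 2)
  have hcl : closure (Set.range (1 - B ^ 2 : X →L[ℂ] X)) =
      ((LinearMap.ker (1 - B ^ 2).toLinearMap)ᗮ : Set X) := by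
    rw [ContinuousLinearMap.orthogonal_ker, ← ContinuousLinearMap.star_eq_adjoint, hsa.star_eq]
    rfl
  rw [hcl, SetLike.mem_coe, Submodule.mem_orthogonal]
  have hin : ∀ g, ⟪g, (1 - B) f⟫_ℂ = ⟪g - B g, f⟫_ℂ := fun g => by
    rw [← inner_apply_of_isSelfAdjoint ((IsSelfAdjoint.one _).sub hB)]
    rfl
  have hker : ∀ g, g ∈ LinearMap.ker (1 - B ^ 2).toLinearMap ↔ g - B (B g) = 0 := fun g => by
    rw [pow_two]
    rfl
  simp only [hin, hker]
  -- If `B g = -g`, then `g - B g = 2 g`. Conversely, if `B² g = g`, then `g - B g` lies in `ker (1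
  -- + B)`.
  constructor
  · intro h g hg
    have h1 := h g (by rw [hg, map_neg, hg, neg_neg, sub_self])
    rw [hg, sub_neg_eq_add, ← two_smul ℂ g, inner_smul_left] at h1
    simpa using h1
  · intro h g hg
    refine h _ ?_
    rw [map_sub, ← sub_eq_zero.1 hg, neg_sub]

end Kernel

/-! ### Operators on Hilbert-space tensor products and coherence of associativity. -/

section TensorOperators

open scoped InnerProductSpace

instance : CoeSort HilbertSpaceCat.{u} (Type u) := ⟨HilbertSpaceCat.carrier⟩

/-- The Hilbert-space tensor product of bundled Hilbert spaces. The instances on its carrier are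
sealed, so that those of nested tensor products are compared syntactically. -/
noncomputable abbrev otensor (E F : HilbertSpaceCat.{u}) : HilbertSpaceCat.{u} := consBundle E F

variable {E F G E' F' G' E'' F'' : HilbertSpaceCat.{u}}
  {W : Type*} [NormedAddCommGroup W] [NormedSpace ℂ W]

/-- The elementary tensor `x ⊗ y`. -/
noncomputable def otmul (x : E) (y : F) : otensor E F := htmul x y

/-- The bounded operator `f ⊗ g`. -/
noncomputable def omap (f : E →L[ℂ] E') (g : F →L[ℂ] F') : otensor E F →L[ℂ] otensor E' F' :=
  hmap f g

theorem omap_otmul (f : E →L[ℂ] E') (g : F →L[ℂ] F') (x : E) (y : F) :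
    omap f g (otmul x y) = otmul (f x) (g y) := hmap_htmul f g x y

/-- Bounded operators on a Hilbert-space tensor product are determined by their values on elementary
tensors. -/
theorem ext_otmul {A B : otensor E F →L[ℂ] W} (h : ∀ x y, A (otmul x y) = B (otmul x y)) :
    A = B := by
  have h1 : (LinearMap.eqLocus A.toLinearMap B.toLinearMap).topologicalClosure = ⊤ :=
    closure_eq_top_of_htmul_mem (denseRange_id (X := E.carrier)) _ h
  have h2 : IsClosed (LinearMap.eqLocus A.toLinearMap B.toLinearMap : Set (otensor E F)) :=
    isClosed_eq A.continuous B.continuous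
  rw [h2.submodule_topologicalClosure_eq] at h1
  ext x
  exact (h1 ▸ Submodule.mem_top : x ∈ LinearMap.eqLocus A.toLinearMap B.toLinearMap)

/-- The elementary tensor as a bounded operator of its first factor. -/
noncomputable def otmulRight (y : F) : E →L[ℂ] otensor E F :=
  (UniformSpace.Completion.toComplL ∘L (TensorProduct.mkL ℂ E F).flip y : E →L[ℂ] HTensor E F)

/-- Freezing the last factor with `otmulRight` leaves bounded operators on a product with one factor
fewer. -/
theorem ext_otmul_left {A B : otensor (otensor E F) G →L[ℂ] W}
    (h : ∀ x y z, A (otmul (otmul x y) z) = B (otmul (otmul x y) z)) : A = B := by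
  refine ext_otmul fun t z => ?_
  have : A ∘L otmulRight z = B ∘L otmulRight z := ext_otmul fun x y => h x y z
  exact DFunLike.congr_fun this t

theorem ext_otmul_left_left {A B : otensor (otensor (otensor E F) G) G' →L[ℂ] W}
    (h : ∀ x y z w, A (otmul (otmul (otmul x y) z) w) = B (otmul (otmul (otmul x y) z) w)) :
    A = B := by
  refine ext_otmul fun t w => ?_
  have : A ∘L otmulRight w = B ∘L otmulRight w := ext_otmul_left fun x y z => h x y z w
  exact DFunLike.congr_fun this t

theorem omap_comp (f : E' →L[ℂ] E'') (g : F' →L[ℂ] F'')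
    (f' : E →L[ℂ] E') (g' : F →L[ℂ] F') :
    omap f g ∘L omap f' g' = omap (f ∘L f') (g ∘L g') :=
  ext_otmul fun x y => by simp [omap_otmul]

theorem omap_omap (f : E' →L[ℂ] E'') (g : F' →L[ℂ] F'')
    (f' : E →L[ℂ] E') (g' : F →L[ℂ] F') (t : otensor E F) :
    omap f g (omap f' g' t) = omap (f ∘L f') (g ∘L g') t :=
  DFunLike.congr_fun (omap_comp f g f' g') t

theorem omap_id_id :
    omap (ContinuousLinearMap.id ℂ E) (ContinuousLinearMap.id ℂ F) = ContinuousLinearMap.id ℂ _ :=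
  ext_otmul fun x y => by simp [omap_otmul]

theorem norm_omap_le (f : E →L[ℂ] E') (g : F →L[ℂ] F') : ‖omap f g‖ ≤ ‖f‖ * ‖g‖ := by
  refine ContinuousLinearMap.opNorm_le_bound _ (by positivity) fun t => ?_
  change ‖hmap f g t‖ ≤ _
  induction t using UniformSpace.Completion.induction_on with
  | hp =>
    exact isClosed_le (hmap f g).continuous.norm (continuous_const.mul continuous_norm)
  | ih t =>
    have : hmap f g (t : HTensor E F) = (TensorProduct.mapL f g t : HTensor E' F') := by
      simp [hmap]
    rw [this, UniformSpace.Completion.norm_coe]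
    refine ((TensorProduct.mapL f g).le_of_opNorm_le (TensorProduct.norm_mapL_le f g) t).trans_eq ?_
    exact congrArg _ (UniformSpace.Completion.norm_coe t).symm

theorem inner_otmul (x x' : E) (y y' : F) :
    ⟪otmul x y, otmul x' y'⟫_ℂ = ⟪x, x'⟫_ℂ * ⟪y, y'⟫_ℂ :=
  (UniformSpace.Completion.inner_coe _ _).trans (TensorProduct.inner_tmul ℂ x x' y y')

theorem adjoint_omap(f : E →L[ℂ] E') (g : F →L[ℂ] F') :
    ContinuousLinearMap.adjoint (omap f g) =
      omap (ContinuousLinearMap.adjoint f) (ContinuousLinearMap.adjoint g) := by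
  refine ext_otmul fun x y => ?_
  refine ext_inner_right ℂ fun t => ?_
  -- Comparing the two vectors as bounded functionals allows the second argument to be an elementary
  -- tensor too.
  have : innerSL ℂ (ContinuousLinearMap.adjoint (omap f g) (otmul x y)) =
      innerSL ℂ (omap (ContinuousLinearMap.adjoint f) (ContinuousLinearMap.adjoint g)
        (otmul x y)) := by
    refine ext_otmul fun x' y' => ?_
    rw [innerSL_apply_apply, innerSL_apply_apply, ContinuousLinearMap.adjoint_inner_left,
      omap_otmul, omap_otmul, inner_otmul, inner_otmul, ContinuousLinearMap.adjoint_inner_left,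
      ContinuousLinearMap.adjoint_inner_left]
  exact DFunLike.congr_fun this t

theorem isSelfAdjoint_omap {f : E →L[ℂ] E} {g : F →L[ℂ] F}
    (hf : IsSelfAdjoint f) (hg : IsSelfAdjoint g) : IsSelfAdjoint (omap f g) := by
  rw [ContinuousLinearMap.isSelfAdjoint_iff'] at *
  rw [adjoint_omap, hf, hg]

variable (E F G) in
/-- The associativity isomorphism. -/
noncomputable def oassoc : otensor (otensor E F) G ≃ₗᵢ[ℂ] otensor E (otensor F G) :=
  hassoc E F G

variable (E F G) in
/-- The associativity isomorphism as a bounded operator. -/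
noncomputable def oassocL : otensor (otensor E F) G →L[ℂ] otensor E (otensor F G) :=
  (oassoc E F G).toContinuousLinearEquiv.toContinuousLinearMap

variable (E F G) in
/-- The inverse of the associativity isomorphism as a bounded operator. -/
noncomputable def oassocSymmL : otensor E (otensor F G) →L[ℂ] otensor (otensor E F) G :=
  (oassoc E F G).symm.toContinuousLinearEquiv.toContinuousLinearMap

theorem oassocL_otmul (x : E) (y : F) (z : G) :
    oassocL E F G (otmul (otmul x y) z) = otmul x (otmul y z) := hassoc_htmul E F G x y z

theorem oassocL_oassocSymmL (t : otensor E (otensor F G)) :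
    oassocL E F G (oassocSymmL E F G t) = t := (oassoc E F G).apply_symm_apply t

theorem oassocSymmL_oassocL (t : otensor (otensor E F) G) :
    oassocSymmL E F G (oassocL E F G t) = t := (oassoc E F G).symm_apply_apply t

theorem oassocL_comp_oassocSymmL :
    oassocL E F G ∘L oassocSymmL E F G = ContinuousLinearMap.id ℂ _ :=
  ContinuousLinearMap.ext oassocL_oassocSymmL

/-- The associativity isomorphism is natural. -/
theorem oassocL_omap (f : E →L[ℂ] E') (g : F →L[ℂ] F') (h : G →L[ℂ] G')
    (t : otensor (otensor E F) G) :
    oassocL E' F' G' (omap (omap f g) h t) = omap f (omap g h) (oassocL E F G t) := by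
  have : oassocL E' F' G' ∘L omap (omap f g) h = omap f (omap g h) ∘L oassocL E F G :=
    ext_otmul_left fun x y z => by
      simp only [ContinuousLinearMap.comp_apply, omap_otmul, oassocL_otmul]
  exact DFunLike.congr_fun this t

theorem oassocSymmL_omap (f : E →L[ℂ] E') (g : F →L[ℂ] F') (h : G →L[ℂ] G')
    (t : otensor E (otensor F G)) :
    oassocSymmL E' F' G' (omap f (omap g h) t) = omap (omap f g) h (oassocSymmL E F G t) := by
  have h1 := oassocL_omap f g h (oassocSymmL E F G t)
  rw [oassocL_oassocSymmL] at h1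
  rw [← h1, oassocSymmL_oassocL]

variable (E F G E') in
/-- The unitary `(E ⊗ (F ⊗ G)) ⊗ E' ≃ E ⊗ (F ⊗ (G ⊗ E'))`. -/
noncomputable def assocThree :
    otensor (otensor E (otensor F G)) E' →L[ℂ] otensor E (otensor F (otensor G E')) :=
  omap (ContinuousLinearMap.id ℂ E) (oassocL F G E') ∘L oassocL E (otensor F G) E'

theorem assocThree_apply (t : otensor (otensor E (otensor F G)) E') :
    assocThree E F G E' t =
      omap (ContinuousLinearMap.id ℂ E) (oassocL F G E') (oassocL E (otensor F G) E' t) := rfl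

theorem assocThree_otmul (x : E) (y : F) (z : G) (w : E') :
    assocThree E F G E' (otmul (otmul x (otmul y z)) w) = otmul x (otmul y (otmul z w)) := by
  rw [assocThree_apply, oassocL_otmul, omap_otmul, oassocL_otmul, ContinuousLinearMap.id_apply]

theorem assocThree_surjective : Function.Surjective (assocThree E F G E') := by
  intro t
  refine ⟨oassocSymmL E (otensor F G) E'
    (omap (ContinuousLinearMap.id ℂ E) (oassocSymmL F G E') t), ?_⟩
  rw [assocThree_apply, oassocL_oassocSymmL, omap_omap, oassocL_comp_oassocSymmL,
    ContinuousLinearMap.comp_id, omap_id_id, ContinuousLinearMap.id_apply]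

/-- The pentagon identity. -/
theorem assocThree_oassocL (t : otensor (otensor (otensor E F) G) E') :
    assocThree E F G E' (omap (oassocL E F G) (ContinuousLinearMap.id ℂ E') t) =
      oassocL E F (otensor G E') (oassocL (otensor E F) G E' t) := by
  have : assocThree E F G E' ∘L omap (oassocL E F G) (ContinuousLinearMap.id ℂ E') =
      oassocL E F (otensor G E') ∘L oassocL (otensor E F) G E' :=
    ext_otmul_left_left fun x y z w => by
      rw [ContinuousLinearMap.comp_apply, ContinuousLinearMap.comp_apply, omap_otmul,
        oassocL_otmul, oassocL_otmul, oassocL_otmul, ContinuousLinearMap.id_apply,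
        assocThree_otmul]
  exact DFunLike.congr_fun this t

end TensorOperators

/-! ### Amplifications of `T` and the Yang–Baxter equation with a spectator factor. -/

section Amplification

variable {H K : HilbertSpaceCat.{u}}

/-- The operator `T ⊗ 1` on `H ⊗ (H ⊗ K)`. -/
noncomputable def oFirstTwo (T : otensor H H →L[ℂ] otensor H H) (K : HilbertSpaceCat.{u}) :
    otensor H (otensor H K) →L[ℂ] otensor H (otensor H K) :=
  oassocL H H K ∘L omap T (ContinuousLinearMap.id ℂ K) ∘L oassocSymmL H H K

theorem oFirstTwo_apply (T : otensor H H →L[ℂ] otensor H H) (t : otensor H (otensor H K)) :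
    oFirstTwo T K t =
      oassocL H H K (omap T (ContinuousLinearMap.id ℂ K) (oassocSymmL H H K t)) := rfl

theorem norm_oFirstTwo_le {T : otensor H H →L[ℂ] otensor H H} (hT : ‖T‖ ≤ 1) :
    ‖oFirstTwo T K‖ ≤ 1 := by
  refine ContinuousLinearMap.opNorm_le_bound _ zero_le_one fun t => ?_
  refine ((oassoc H H K).norm_map _).trans_le ?_
  refine (ContinuousLinearMap.le_of_opNorm_le _ (norm_omap_le T _) _).trans ?_
  refine mul_le_mul ?_ ((oassoc H H K).symm.norm_map t).le (norm_nonneg _) zero_le_one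
  exact mul_le_one₀ hT (norm_nonneg _) ContinuousLinearMap.norm_id_le

theorem norm_omap_id_le {A : K →L[ℂ] K} (hA : ‖A‖ ≤ 1) :
    ‖omap (ContinuousLinearMap.id ℂ H) A‖ ≤ 1 :=
  (norm_omap_le _ _).trans (mul_le_one₀ ContinuousLinearMap.norm_id_le (norm_nonneg _) hA)

theorem isSelfAdjoint_oFirstTwo {T : otensor H H →L[ℂ] otensor H H} (hT : IsSelfAdjoint T) :
    IsSelfAdjoint (oFirstTwo T K) := by
  rw [ContinuousLinearMap.isSelfAdjoint_iff_isSymmetric]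
  intro x y
  have h : IsSelfAdjoint (omap T (ContinuousLinearMap.id ℂ K)) :=
    isSelfAdjoint_omap hT (IsSelfAdjoint.one (K →L[ℂ] K))
  change inner ℂ (oFirstTwo T K x) y = inner ℂ x (oFirstTwo T K y)
  obtain ⟨x, rfl⟩ := (oassoc H H K).surjective x
  obtain ⟨y, rfl⟩ := (oassoc H H K).surjective y
  change inner ℂ (oassoc H H K (omap T (ContinuousLinearMap.id ℂ K) ((oassoc H H K).symm _))) _ =
    inner ℂ _ (oassoc H H K (omap T (ContinuousLinearMap.id ℂ K) ((oassoc H H K).symm _)))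
  rw [(oassoc H H K).inner_map_map, (oassoc H H K).inner_map_map,
    (oassoc H H K).symm_apply_apply, (oassoc H H K).symm_apply_apply,
    inner_apply_of_isSelfAdjoint h]

/-- By naturality of associativity both sides are conjugate to `T ⊗ A` on `(H ⊗ H) ⊗ K`. -/
theorem oFirstTwo_comm (T : otensor H H →L[ℂ] otensor H H) (A : K →L[ℂ] K) :
    oFirstTwo T K ∘L
        omap (ContinuousLinearMap.id ℂ H) (omap (ContinuousLinearMap.id ℂ H) A) =
      omap (ContinuousLinearMap.id ℂ H) (omap (ContinuousLinearMap.id ℂ H) A) ∘L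
        oFirstTwo T K := by
  ext t
  simp only [ContinuousLinearMap.comp_apply, oFirstTwo_apply, oassocSymmL_omap, ← oassocL_omap,
    omap_omap, omap_id_id, ContinuousLinearMap.comp_id, ContinuousLinearMap.id_comp]

theorem assocThree_omap_tail (T : otensor H H →L[ℂ] otensor H H)
    (t : otensor (otensor H (otensor H H)) K) :
    assocThree H H H K
        (omap (omap (ContinuousLinearMap.id ℂ H) T) (ContinuousLinearMap.id ℂ K) t) =
      omap (ContinuousLinearMap.id ℂ H) (oFirstTwo T K) (assocThree H H H K t) := by
  have h : oassocL H H K ∘L omap T (ContinuousLinearMap.id ℂ K) =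
      oFirstTwo T K ∘L oassocL H H K := by
    ext s
    rw [ContinuousLinearMap.comp_apply, ContinuousLinearMap.comp_apply, oFirstTwo_apply,
      oassocSymmL_oassocL]
  rw [assocThree_apply, assocThree_apply, oassocL_omap, omap_omap, omap_omap, h]

theorem assocThree_omap_oFirstTwo (T : otensor H H →L[ℂ] otensor H H)
    (t : otensor (otensor H (otensor H H)) K) :
    assocThree H H H K (omap (oFirstTwo T H) (ContinuousLinearMap.id ℂ K) t) =
      oFirstTwo T (otensor H K) (assocThree H H H K t) := by
  -- Writing `t` as a reassociated vector makes the pentagon identity applicable.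
  obtain ⟨s, rfl⟩ : ∃ s, omap (oassocL H H H) (ContinuousLinearMap.id ℂ K) s = t := by
    refine ⟨omap (oassocSymmL H H H) (ContinuousLinearMap.id ℂ K) t, ?_⟩
    rw [omap_omap, oassocL_comp_oassocSymmL, ContinuousLinearMap.comp_id, omap_id_id,
      ContinuousLinearMap.id_apply]
  have h : oFirstTwo T H ∘L oassocL H H H =
      oassocL H H H ∘L omap T (ContinuousLinearMap.id ℂ H) := by
    ext s
    rw [ContinuousLinearMap.comp_apply, ContinuousLinearMap.comp_apply, oFirstTwo_apply,
      oassocSymmL_oassocL]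
  rw [omap_omap, h, ← omap_omap, assocThree_oassocL, assocThree_oassocL, oassocL_omap, omap_id_id,
    oFirstTwo_apply, oassocSymmL_oassocL]

/-- The Yang–Baxter equation for an operator between bundled tensor squares. -/
def OYangBaxter (T : otensor H H →L[ℂ] otensor H H) : Prop :=
  ∀ t, oFirstTwo T H (omap (ContinuousLinearMap.id ℂ H) T (oFirstTwo T H t)) =
    omap (ContinuousLinearMap.id ℂ H) T (oFirstTwo T H (omap (ContinuousLinearMap.id ℂ H) T t))

/-- The Yang–Baxter equation on `H ⊗ H ⊗ H ⊗ K`. -/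
theorem oFirstTwo_braid {T : otensor H H →L[ℂ] otensor H H}
    (hT : OYangBaxter T) (t : otensor H (otensor H (otensor H K))) :
    oFirstTwo T (otensor H K)
        (omap (ContinuousLinearMap.id ℂ H) (oFirstTwo T K) (oFirstTwo T (otensor H K) t)) =
      omap (ContinuousLinearMap.id ℂ H) (oFirstTwo T K)
        (oFirstTwo T (otensor H K) (omap (ContinuousLinearMap.id ℂ H) (oFirstTwo T K) t)) := by
  have hT' : oFirstTwo T H ∘L omap (ContinuousLinearMap.id ℂ H) T ∘L oFirstTwo T H =
      omap (ContinuousLinearMap.id ℂ H) T ∘L oFirstTwo T H ∘L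
        omap (ContinuousLinearMap.id ℂ H) T := ContinuousLinearMap.ext hT
  -- Transported to `(H ⊗ (H ⊗ H)) ⊗ K`, both sides have the form `X ⊗ 1`, with `X` a side of the
  -- equation on `H ⊗ (H ⊗ H)`.
  obtain ⟨s, rfl⟩ := assocThree_surjective t
  simp only [← assocThree_omap_tail, ← assocThree_omap_oFirstTwo, omap_omap,
    ContinuousLinearMap.comp_id]
  rw [hT']

end Amplification

/-! ### The operators `T_i` on tensor powers and the theorem. -/

section Powers

variable {H : HilbertSpaceCat.{u}} {T : HTensor H H →L[ℂ] HTensor H H}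

/-- The Yang–Baxter operator, between the bundled tensor squares. -/
noncomputable def bundleOp (T : HTensor H H →L[ℂ] HTensor H H) :
    otensor H H →L[ℂ] otensor H H := T

theorem consFirstTwo_eq (T : HTensor H H →L[ℂ] HTensor H H) (K : HilbertSpaceCat.{u}) :
    consFirstTwo T K = oFirstTwo (H := H) (bundleOp T) K := rfl

theorem consTail_eq {K : HilbertSpaceCat.{u}} (A : K →L[ℂ] K) :
    consTail (H := H.carrier) A = omap (ContinuousLinearMap.id ℂ H) A := rfl

theorem consTail_consTail {K : HilbertSpaceCat.{u}} (A B : K →L[ℂ] K)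
    (t : otensor H K) : consTail A (consTail B t) = consTail (A ∘L B) t :=
  omap_omap (ContinuousLinearMap.id ℂ H) A (ContinuousLinearMap.id ℂ H) B t

theorem consTail_braid {K : HilbertSpaceCat.{u}} {A B : K →L[ℂ] K}
    (h : ∀ t, A (B (A t)) = B (A (B t))) (t : otensor H K) :
    consTail A (consTail B (consTail A t)) = consTail B (consTail A (consTail B t)) := by
  have h' : A ∘L B ∘L A = B ∘L A ∘L B := ContinuousLinearMap.ext h
  simp only [consTail_consTail, h']

theorem consTail_comm {K : HilbertSpaceCat.{u}} {A B : K →L[ℂ] K} (h : ∀ t, A (B t) = B (A t))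
    (t : otensor H K) :
    consTail A (consTail B t) = consTail B (consTail A t) := by
  have h' : A ∘L B = B ∘L A := ContinuousLinearMap.ext h
  rw [consTail_consTail, consTail_consTail, h']

theorem YangBaxter.bundleOp (hT : YangBaxter T) : OYangBaxter (bundleOp T) :=
  fun t => DFunLike.congr_fun hT t

theorem consFirstTwo_braid (hT : YangBaxter T) (K : HilbertSpaceCat.{u})
    (t : otensor H (otensor H (otensor H K))) :
    consFirstTwo T (otensor H K) (consTail (consFirstTwo T K) (consFirstTwo T (otensor H K) t)) =
      consTail (consFirstTwo T K) (consFirstTwo T (otensor H K)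
        (consTail (consFirstTwo T K) t)) := by
  have h := oFirstTwo_braid (K := K) hT.bundleOp t
  rw [consFirstTwo_eq, consFirstTwo_eq, consTail_eq]
  exact h

theorem consFirstTwo_comm (T : HTensor H H →L[ℂ] HTensor H H) {K : HilbertSpaceCat.{u}}
    (A : K →L[ℂ] K) (t : otensor H (otensor H K)) :
    consFirstTwo T K (consTail (consTail A) t) = consTail (consTail A) (consFirstTwo T K t) :=
  DFunLike.congr_fun (oFirstTwo_comm (bundleOp T) A) t

theorem isSelfAdjoint_consFirstTwo (hT : IsSelfAdjoint T) (K : HilbertSpaceCat.{u}) :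
    IsSelfAdjoint (consFirstTwo T K) := by
  rw [consFirstTwo_eq]
  exact isSelfAdjoint_oFirstTwo (H := H) (T := bundleOp T) hT

theorem isSelfAdjoint_consTail {K : HilbertSpaceCat.{u}} {A : K →L[ℂ] K} (hA : IsSelfAdjoint A) :
    IsSelfAdjoint (consTail (H := H.carrier) A) := by
  rw [consTail_eq]
  exact isSelfAdjoint_omap (IsSelfAdjoint.one (H →L[ℂ] H)) hA

theorem norm_consFirstTwo_le (hT : ‖T‖ ≤ 1) (K : HilbertSpaceCat.{u}) :
    ‖consFirstTwo T K‖ ≤ 1 := by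
  rw [consFirstTwo_eq]
  exact norm_oFirstTwo_le (H := H) (T := bundleOp T) hT

theorem norm_consTail_le {K : HilbertSpaceCat.{u}} {A : K →L[ℂ] K} (hA : ‖A‖ ≤ 1) :
    ‖consTail (H := H.carrier) A‖ ≤ 1 := by
  rw [consTail_eq]
  exact norm_omap_id_le (H := H) hA

theorem isSelfAdjoint_amp (hT : IsSelfAdjoint T) :
    ∀ (n : ℕ) (i : Fin (n - 1)), IsSelfAdjoint (amp T n i)
  | 0, i => i.elim0
  | 1, i => i.elim0
  | 2, _ => hT
  | n + 3, ⟨0, _⟩ => isSelfAdjoint_consFirstTwo hT (powBundle H.carrier (n + 1))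
  | n + 3, ⟨j + 1, h⟩ => isSelfAdjoint_consTail (K := powBundle H.carrier (n + 2))
      (isSelfAdjoint_amp hT (n + 2) ⟨j, by omega⟩)

theorem norm_amp_le (hT : ‖T‖ ≤ 1) : ∀ (n : ℕ) (i : Fin (n - 1)), ‖amp T n i‖ ≤ 1
  | 0, i => i.elim0
  | 1, i => i.elim0
  | 2, _ => hT
  | n + 3, ⟨0, _⟩ => norm_consFirstTwo_le hT (powBundle H.carrier (n + 1))
  | n + 3, ⟨j + 1, h⟩ => norm_consTail_le (K := powBundle H.carrier (n + 2))
      (norm_amp_le hT (n + 2) ⟨j, by omega⟩)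

/-- Tensor powers become nested products only on unfolding `powBundle`. With the spaces as variables
and the operators known up to `HEq`, `subst` makes the identification. -/
theorem consFirstTwo_braid_of_heq (hT : YangBaxter T) {K K₁ K₂ K₃ : HilbertSpaceCat.{u}}
    (h₁ : K₁ = otensor H K) (h₂ : K₂ = otensor H K₁) (h₃ : K₃ = otensor H K₂)
    {A B : K₃ →L[ℂ] K₃} {C : K₂ →L[ℂ] K₂} (hA : A ≍ consFirstTwo T K₁)
    (hB : B ≍ consTail (H := H) C)
    (hC : C ≍ consFirstTwo T K) (t : K₃) : A (B (A t)) = B (A (B t)) := by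
  subst h₁ h₂ h₃
  obtain rfl := eq_of_heq hC
  obtain rfl := eq_of_heq hB
  obtain rfl := eq_of_heq hA
  exact consFirstTwo_braid hT K t

theorem consFirstTwo_comm_of_heq (T : HTensor H H →L[ℂ] HTensor H H)
    {K K₁ K₂ : HilbertSpaceCat.{u}} (h₁ : K₁ = otensor H K) (h₂ : K₂ = otensor H K₁)
    {A B : K₂ →L[ℂ] K₂} {C : K₁ →L[ℂ] K₁} {D : K →L[ℂ] K} (hA : A ≍ consFirstTwo T K)
    (hB : B ≍ consTail (H := H) C) (hC : C ≍ consTail (H := H) D) (t : K₂) :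
    A (B t) = B (A t) := by
  subst h₁ h₂
  obtain rfl := eq_of_heq hC
  obtain rfl := eq_of_heq hB
  obtain rfl := eq_of_heq hA
  exact consFirstTwo_comm T D t

/-- The operator `T_i` on the carrier of the bundled tensor power. -/
noncomputable def bundleAmp (T : HTensor H H →L[ℂ] HTensor H H) (n : ℕ) (i : Fin (n - 1)) :
    powBundle H.carrier n →L[ℂ] powBundle H.carrier n := amp T n i

theorem bundleAmp_zero (T : HTensor H H →L[ℂ] HTensor H H) {n m : ℕ} (hm : n + 3 = m)
    {K : HilbertSpaceCat.{u}} (hK : powBundle H.carrier (n + 1) = K) (h : 0 < m - 1) :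
    bundleAmp T m ⟨0, h⟩ ≍ consFirstTwo T K := by
  subst hm hK
  exact HEq.rfl

theorem bundleAmp_succ (T : HTensor H H →L[ℂ] HTensor H H) (n j : ℕ) (h : j + 1 < n + 3 - 1) :
    bundleAmp T (n + 3) ⟨j + 1, h⟩ ≍
      consTail (H := H) (K := powBundle H.carrier (n + 2)) (bundleAmp T (n + 2) ⟨j, by omega⟩) :=
  HEq.rfl

theorem bundleAmp_braid_zero (hT : YangBaxter T) (n : ℕ) (h₀ : 0 < n + 4 - 1)
    (h₁ : 0 + 1 < n + 4 - 1) (t : powBundle H.carrier (n + 4)) :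
    bundleAmp T (n + 4) ⟨0, h₀⟩ (bundleAmp T (n + 4) ⟨0 + 1, h₁⟩ (bundleAmp T (n + 4) ⟨0, h₀⟩ t)) =
      bundleAmp T (n + 4) ⟨0 + 1, h₁⟩
        (bundleAmp T (n + 4) ⟨0, h₀⟩ (bundleAmp T (n + 4) ⟨0 + 1, h₁⟩ t)) := by
  refine consFirstTwo_braid_of_heq hT (K := powBundle H.carrier (n + 1))
    (K₁ := powBundle H.carrier (n + 2)) (K₂ := powBundle H.carrier (n + 3))
    (K₃ := powBundle H.carrier (n + 4)) (C := bundleAmp T (n + 3) ⟨0, by omega⟩)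
    rfl rfl rfl ?_ ?_ ?_ t
  · exact bundleAmp_zero T (n := n + 1) (m := n + 4) rfl (K := powBundle H.carrier (n + 2)) rfl h₀
  · exact bundleAmp_succ T (n + 1) 0 h₁
  · exact bundleAmp_zero T (n := n) (m := n + 3) rfl (K := powBundle H.carrier (n + 1)) rfl _

theorem bundleAmp_comm_zero (T : HTensor H H →L[ℂ] HTensor H H) (n j : ℕ) (h₀ : 0 < n + 4 - 1)
    (h₁ : j + 1 + 1 < n + 4 - 1) (t : powBundle H.carrier (n + 4)) :
    bundleAmp T (n + 4) ⟨0, h₀⟩ (bundleAmp T (n + 4) ⟨j + 1 + 1, h₁⟩ t) =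
      bundleAmp T (n + 4) ⟨j + 1 + 1, h₁⟩ (bundleAmp T (n + 4) ⟨0, h₀⟩ t) := by
  refine consFirstTwo_comm_of_heq T (K := powBundle H.carrier (n + 2))
    (K₁ := powBundle H.carrier (n + 3)) (K₂ := powBundle H.carrier (n + 4))
    (C := bundleAmp T (n + 3) ⟨j + 1, by omega⟩) (D := bundleAmp T (n + 2) ⟨j, by omega⟩)
    rfl rfl ?_ ?_ ?_ t
  · exact bundleAmp_zero T (n := n + 1) (m := n + 4) rfl (K := powBundle H.carrier (n + 2)) rfl h₀
  · exact bundleAmp_succ T (n + 1) (j + 1) h₁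
  · exact bundleAmp_succ T n j _

theorem bundleAmp_braid_succ (n i j : ℕ) (hi : i < n + 1) (hj : j < n + 1)
    (h : ∀ t, bundleAmp T (n + 2) ⟨i, hi⟩
        (bundleAmp T (n + 2) ⟨j, hj⟩ (bundleAmp T (n + 2) ⟨i, hi⟩ t)) =
      bundleAmp T (n + 2) ⟨j, hj⟩ (bundleAmp T (n + 2) ⟨i, hi⟩ (bundleAmp T (n + 2) ⟨j, hj⟩ t)))
    (t : powBundle H.carrier (n + 3)) :
    bundleAmp T (n + 3) ⟨i + 1, by omega⟩
        (bundleAmp T (n + 3) ⟨j + 1, by omega⟩ (bundleAmp T (n + 3) ⟨i + 1, by omega⟩ t)) =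
      bundleAmp T (n + 3) ⟨j + 1, by omega⟩
        (bundleAmp T (n + 3) ⟨i + 1, by omega⟩ (bundleAmp T (n + 3) ⟨j + 1, by omega⟩ t)) :=
  consTail_braid (K := powBundle H.carrier (n + 2)) h t

theorem bundleAmp_comm_succ (n i j : ℕ) (hi : i < n + 1) (hj : j < n + 1)
    (h : ∀ t, bundleAmp T (n + 2) ⟨i, hi⟩ (bundleAmp T (n + 2) ⟨j, hj⟩ t) =
      bundleAmp T (n + 2) ⟨j, hj⟩ (bundleAmp T (n + 2) ⟨i, hi⟩ t))
    (t : powBundle H.carrier (n + 3)) :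
    bundleAmp T (n + 3) ⟨i + 1, by omega⟩ (bundleAmp T (n + 3) ⟨j + 1, by omega⟩ t) =
      bundleAmp T (n + 3) ⟨j + 1, by omega⟩ (bundleAmp T (n + 3) ⟨i + 1, by omega⟩ t) :=
  consTail_comm (K := powBundle H.carrier (n + 2)) h t

/-- Common leading identity factors are stripped until the pair is `T_1, T_2`. The case `n = 3` is
separate because there the tail operator is `T` itself, as `amp` on the second power is not a
`consFirstTwo`. -/
theorem bundleAmp_braid (hT : YangBaxter T) : ∀ (n : ℕ) (i j : Fin (n - 1)), (i : ℕ) + 1 = j →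
    ∀ t, bundleAmp T n i (bundleAmp T n j (bundleAmp T n i t)) =
      bundleAmp T n j (bundleAmp T n i (bundleAmp T n j t))
  | 0, i, _, _ => i.elim0
  | 1, i, _, _ => i.elim0
  | 2, i, j, h => by omega
  | 3, ⟨0, _⟩, ⟨1, _⟩, _ => fun t => DFunLike.congr_fun hT t
  | n + 4, ⟨0, h₀⟩, ⟨1, h₁⟩, _ => bundleAmp_braid_zero hT n h₀ h₁
  | n + 3, ⟨i + 1, hi⟩, ⟨j + 1, hj⟩, h =>
    bundleAmp_braid_succ n i j (by omega) (by omega)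
      (bundleAmp_braid hT (n + 2) ⟨i, by omega⟩ ⟨j, by omega⟩ (by simpa using h))

theorem bundleAmp_comm (T : HTensor H H →L[ℂ] HTensor H H) : ∀ (n : ℕ) (i j : Fin (n - 1)),
    (i : ℕ) + 1 < j → ∀ t, bundleAmp T n i (bundleAmp T n j t) = bundleAmp T n j (bundleAmp T n i t)
  | 0, i, _, _ => i.elim0
  | 1, i, _, _ => i.elim0
  | 2, i, j, h => by omega
  | 3, i, j, h => by omega
  | n + 4, ⟨0, h₀⟩, ⟨j + 2, hj⟩, _ => bundleAmp_comm_zero T n j h₀ hj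
  | n + 3, ⟨i + 1, hi⟩, ⟨j + 1, hj⟩, h =>
    bundleAmp_comm_succ n i j (by omega) (by omega)
      (bundleAmp_comm T (n + 2) ⟨i, by omega⟩ ⟨j, by omega⟩ (by simpa using h))

theorem YangBaxter.braidFamily_amp (hT : YangBaxter T) (n : ℕ) : BraidFamily (amp T n) :=
  ⟨fun i j h => ContinuousLinearMap.ext (bundleAmp_braid hT n i j h),
    fun i j h => ContinuousLinearMap.ext (bundleAmp_comm T n i j h)⟩

theorem symmetrizer_eq_parabolicSum (T : HTensor H H →L[ℂ] HTensor H H) (n : ℕ) :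
    symmetrizer T n = parabolicSum (amp T n) Finset.univ := by
  have : parabolicFinset (Finset.univ : Finset (Fin (n - 1))) = Finset.univ := by
    ext σ
    simp
  rw [parabolicSum, this]
  rfl

/-- The description of the `n`-particle space, for a bundled Hilbert space. -/
theorem mem_nParticleSpace_iff (hs : IsSelfAdjoint T) (hn : ‖T‖ ≤ 1) (hT : YangBaxter T) (n : ℕ)
    (f : Pow H n) :
    f ∈ nParticleSpace T n ↔ ∀ i : Fin (n - 1), (1 - amp T n i : Pow H n →L[ℂ] Pow H n) f ∈
      closure (Set.range (1 - amp T n i ^ 2 : Pow H n →L[ℂ] Pow H n)) := by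
  have hs' := isSelfAdjoint_amp hs n
  rw [nParticleSpace, symmetrizer_eq_parabolicSum,
    ← hT.braidFamily_amp n |>.orthKer_eq hs' (norm_amp_le hn n), mem_orthKer]
  simp only [Finset.mem_univ, true_imp_iff]
  exact forall_congr' fun i => (one_sub_apply_mem_closure_range_iff (hs' i) f).symm

end Powers

end HilbertTensor

theorem theorem2p2 {H : Type*} [NormedAddCommGroup H] [InnerProductSpace ℂ H] [CompleteSpace H]
    [TopologicalSpace.SeparableSpace H]
    (T : HilbertTensor.HTensor H H →L[ℂ] HilbertTensor.HTensor H H)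
    (hT_sa : IsSelfAdjoint T) (hT_norm : ‖T‖ ≤ 1) (hT_yb : HilbertTensor.YangBaxter T)
    (n : ℕ) (hn : 2 ≤ n) :
    (HilbertTensor.nParticleSpace T n : Set (HilbertTensor.Pow H n)) =
      {f | ∀ i : Fin (n - 1),
        (1 - HilbertTensor.amp T n i : HilbertTensor.Pow H n →L[ℂ] HilbertTensor.Pow H n) f ∈
          closure (Set.range (1 - HilbertTensor.amp T n i ^ 2 :
            HilbertTensor.Pow H n →L[ℂ] HilbertTensor.Pow H n))} :=
  Set.ext fun f => HilbertTensor.mem_nParticleSpace_iff (H := ⟨H⟩) hT_sa hT_norm hT_yb n f
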